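/- **Setting.** A local system is a finite-dimensional Hilbert space with an orthonormal basis of eigenvectors of a particle number operator with eigenvalues in $\{0,1,2,\dots\}$; particle numbers add up under tensor products. A pure state shared by Alice and Bob is a unit vector that is an eigenvector of the total particle number $\hat N_A+\hat N_B$ (superselection rule, SSR). An SSR-LOCC protocol consists of finitely many rounds; in each round one party performs a local measurement with finitely many Kraus operators $K_i$, $\sum_i K_i^\dagger K_i=1$, where each $K_i$ changes the local particle number by a fixed integer $\Delta_i$ (so local ancillas of definite particle number may be added, and local subsystems discarded), and announces the outcome, on which all later rounds may depend; at the end the outcomes are forgotten. Write $\chi\xrightarrow{\ \varepsilon\ }\psi$ if some SSR-LOCC protocol maps $|\chi\rangle\langle\chi|$ to a state $\rho$ with $\langle\psi|\rho|\psi\rangle\ge 1-\varepsilon$. For a pure bipartite state $\psi$ let $E(\psi)$ be the entropy of entanglement (the von Neumann entropy, with logarithm to base $2$, of Alice's reduced state), and let $V(\psi)=4\left(\langle\psi|\hat N_A^2|\psi\rangle-\langle\psi|\hat N_A|\psi\rangle^2\right)$ be the superselection induced variance. A qubit is a local system with basis $|0\rangle,|1\rangle$ of zero and one particle. Let $$|\text{V-EPR}\rangle=\tfrac1{\sqrt2}\left(|0\rangle_A|1\rangle_B+|1\rangle_A|0\rangle_B\right),\qquad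 |\text{E-EPR}\rangle=\tfrac1{\sqrt2}\left(|01\rangle_A|10\rangle_B+|10\rangle_A|01\rangle_B\right).$$ **Corollary.** Let $\phi$ be a pure state (compatible with the SSR) of two qubits, one held by Alice and one by Bob. Then $E(\phi)\ge V(\phi)$, and asymptotically $$|\phi\rangle\longleftrightarrow|\text{E-EPR}\rangle^{\otimes[E(\phi)-V(\phi)]}\otimes|\text{V-EPR}\rangle^{\otimes V(\phi)}$$ in the following sense: for all $\delta,\varepsilon>0$ there is $N_0$ such that for all $N\ge N_0$ $$|\phi\rangle^{\otimes N}\xrightarrow{\ \varepsilon\ }|\text{E-EPR}\rangle^{\otimes e_N^-}\otimes|\text{V-EPR}\rangle^{\otimes v_N}\qquad\text{and}\qquad|\text{E-EPR}\rangle^{\otimes e_N^+}\otimes|\text{V-EPR}\rangle^{\otimes v_N}\xrightarrow{\ \varepsilon\ }|\phi\rangle^{\otimes N},$$ where $v_N=\lfloor N\,V(\phi)\rfloor$, $e_N^-=\max\{0,\lfloor N(E(\phi)-V(\phi)-\delta)\rfloor\}$ and $e_N^+=\lceil N(E(\phi)-V(\phi)+\delta)\rceil$. -/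

import Mathlib

open scoped Matrix Kronecker

noncomputable section

namespace SSR

/-- A finite-dimensional local quantum system with a particle number: an orthonormal basis `ι` of
eigenvectors of the particle number operator, `num i` being the number of particles in `i`. -/
structure LocalSystem where
  ι : Type
  [fin : Fintype ι]
  [dec : DecidableEq ι]
  num : ι → ℕ

attribute [instance] LocalSystem.fin LocalSystem.dec

/-- Composition of two local systems held by the same party; particle numbers add up. -/
abbrev LocalSystem.tensor (A B : LocalSystem) : LocalSystem where
  ι := A.ι × B.ι
  num x := A.num x.1 + B.num x.2

/-- `N` copies of a local system. -/
abbrev LocalSystem.pow (A : LocalSystem) (N : ℕ) : LocalSystem where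
  ι := Fin N → A.ι
  num x := ∑ k, A.num (x k)

/-- A single mode with basis `|0⟩`, `|1⟩` of zero and one particle. -/
abbrev qubit : LocalSystem where
  ι := Fin 2
  num i := (i : ℕ)

/-- Vectors of the bipartite space `H_A ⊗ H_B`. -/
abbrev Ket (A B : LocalSystem) : Type := A.ι × B.ι → ℂ

/-- Operators from `H_A ⊗ H_B` to itself. -/
abbrev Op (A B : LocalSystem) : Type := Matrix (A.ι × B.ι) (A.ι × B.ι) ℂ

/-- A pure state compatible with the superselection rule: a unit vector that is an eigenvector of
the total particle number. -/
def IsPureState {A B : LocalSystem} (ψ : Ket A B) : Prop :=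
  ∑ x, ‖ψ x‖ ^ 2 = 1 ∧ ∃ n : ℕ, ∀ a b, ψ (a, b) ≠ 0 → A.num a + B.num b = n

/-- The tensor product of two bipartite vectors, as a bipartite vector `A₁A₂ : B₁B₂`. -/
def Ket.tensor {A₁ B₁ A₂ B₂ : LocalSystem} (ψ₁ : Ket A₁ B₁) (ψ₂ : Ket A₂ B₂) :
    Ket (A₁.tensor A₂) (B₁.tensor B₂) :=
  fun x => ψ₁ (x.1.1, x.2.1) * ψ₂ (x.1.2, x.2.2)

/-- `N` copies of a bipartite vector. -/
def Ket.pow {A B : LocalSystem} (ψ : Ket A B) (N : ℕ) : Ket (A.pow N) (B.pow N) :=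
  fun x => ∏ k, ψ (x.1 k, x.2 k)

/-- `(|0⟩_A |1⟩_B + |1⟩_A |0⟩_B) / √2`. -/
def vEPR : Ket qubit qubit := fun x =>
  if x = (0, 1) ∨ x = (1, 0) then ((Real.sqrt 2 : ℝ) : ℂ)⁻¹ else 0

/-- `(|01⟩_A |10⟩_B + |10⟩_A |01⟩_B) / √2`, each party holding two modes. -/
def eEPR : Ket (qubit.tensor qubit) (qubit.tensor qubit) := fun x =>
  if x = ((0, 1), (1, 0)) ∨ x = ((1, 0), (0, 1)) then ((Real.sqrt 2 : ℝ) : ℂ)⁻¹ else 0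

/-- The rank one operator `|ψ⟩⟨ψ|`. -/
def Ket.proj {A B : LocalSystem} (ψ : Ket A B) : Op A B := Matrix.vecMulVec ψ (star ψ)

/-- `⟨ψ| O |ψ⟩` (its real part, which is all of it for Hermitian `O`). -/
def Ket.expect {A B : LocalSystem} (ψ : Ket A B) (O : Op A B) : ℝ := (star ψ ⬝ᵥ (O *ᵥ ψ)).re

/-- Alice's reduced density operator `tr_B |ψ⟩⟨ψ|`. -/
def Ket.reducedA {A B : LocalSystem} (ψ : Ket A B) : Matrix A.ι A.ι ℂ :=
  Matrix.of fun a a' => ∑ b, ψ.proj (a, b) (a', b)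

theorem Ket.reducedA_isHermitian {A B : LocalSystem} (ψ : Ket A B) : ψ.reducedA.IsHermitian := by
  ext a a'
  simp [Ket.reducedA, Ket.proj, Matrix.vecMulVec_apply, mul_comm]

/-- Entropy of entanglement: the von Neumann entropy, in bits, of Alice's reduced state. -/
def Ket.entanglement {A B : LocalSystem} (ψ : Ket A B) : ℝ :=
  (∑ a, Real.negMulLog (ψ.reducedA_isHermitian.eigenvalues a)) / Real.log 2

/-- Alice's particle number operator `N_A ⊗ 1`. -/
def numA (A B : LocalSystem) : Op A B :=
  Matrix.diagonal (fun a => (A.num a : ℂ)) ⊗ₖ (1 : Matrix B.ι B.ι ℂ)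

/-- Superselection induced variance `4 (⟨N_A²⟩ - ⟨N_A⟩²)`. -/
def Ket.siv {A B : LocalSystem} (ψ : Ket A B) : ℝ :=
  4 * (ψ.expect (numA A B * numA A B) - ψ.expect (numA A B) ^ 2)

/-- A local generalized measurement allowed by the superselection rule (with ancillas): the Kraus
operators are complete and each of them shifts the local particle number by a fixed amount `Δ`,
which may depend on the outcome. The system after the measurement may depend on the outcome;
appending or discarding local subsystems is included. -/
def IsMeasurement {A : LocalSystem} {r : ℕ} {C : Fin r → LocalSystem}
    (K : (i : Fin r) → Matrix (C i).ι A.ι ℂ) : Prop :=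
  ∑ i, (K i)ᴴ * K i = 1 ∧
    ∀ i, ∃ Δ : ℤ, ∀ c a, K i c a ≠ 0 → ((C i).num c : ℤ) = (A.num a : ℤ) + Δ

/-- `SSRLOCC A' B' A B Λ`: the map `Λ` from operators on `A : B` to operators on `A' : B'` is
carried out by a finite protocol of local measurements allowed by the superselection rule and
classical communication: in each round one party measures and announces the outcome `i`, on which
all that follows (`Λ i`) may depend. In the end the outcomes are forgotten. -/
inductive SSRLOCC (A' B' : LocalSystem) :
    (A B : LocalSystem) → (Op A B → Op A' B') → Prop
  | done : SSRLOCC A' B' A' B' (fun ρ => ρ)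
  | alice {A B : LocalSystem} {r : ℕ} {C : Fin r → LocalSystem}
      (K : (i : Fin r) → Matrix (C i).ι A.ι ℂ) (hK : IsMeasurement K)
      (Λ : (i : Fin r) → Op (C i) B → Op A' B')
      (hΛ : ∀ i, SSRLOCC A' B' (C i) B (Λ i)) :
      SSRLOCC A' B' A B (fun ρ => ∑ i, Λ i
        ((K i ⊗ₖ (1 : Matrix B.ι B.ι ℂ)) * ρ * (K i ⊗ₖ (1 : Matrix B.ι B.ι ℂ))ᴴ))
  | bob {A B : LocalSystem} {r : ℕ} {C : Fin r → LocalSystem}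
      (K : (i : Fin r) → Matrix (C i).ι B.ι ℂ) (hK : IsMeasurement K)
      (Λ : (i : Fin r) → Op A (C i) → Op A' B')
      (hΛ : ∀ i, SSRLOCC A' B' A (C i) (Λ i)) :
      SSRLOCC A' B' A B (fun ρ => ∑ i, Λ i
        (((1 : Matrix A.ι A.ι ℂ) ⊗ₖ K i) * ρ * ((1 : Matrix A.ι A.ι ℂ) ⊗ₖ K i)ᴴ))

/-- Some SSR-LOCC protocol turns `φ` into a state whose fidelity `⟨ψ|ρ|ψ⟩` with `ψ` is at least
`1 - ε`. -/
def Converts {A B A' B' : LocalSystem} (φ : Ket A B) (ψ : Ket A' B') (ε : ℝ) : Prop :=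
  ∃ Λ : Op A B → Op A' B', SSRLOCC A' B' A B Λ ∧ 1 - ε ≤ ψ.expect (Λ φ.proj)

end SSR

end

/-! Let `p` be the probability that Alice's mode is occupied and suppose `0 < p < 1`; then `φ` is a
superposition of `|0⟩|1⟩` and `|1⟩|0⟩`. In Schmidt bases of definite local particle number, `φ.pow
N` and the EPR state split into blocks labelled by Alice's particle number, and inside a block all
Schmidt coefficients have equal modulus. Each state is thus a coherent superposition of maximally
entangled states. For `φ.pow N` block `n` has dimension `N.choose n` and probability `P n =
binomialProb N p n`; for `e` E-EPR and `v` V-EPR pairs block `m` has dimension `2 ^ e * v.choose m`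
and probability `Q m = binomialProb v (1/2) m`.

By `converts_of_blocks`, a protocol can shift the label by a constant and shrink all blocks at once
without disturbing their coherence. The fidelity is `(∑ √(P Q))²`, so two things are needed.
Distributions: for `v ≈ 4p(1-p)N` the variances agree, and by `exists_window` the two binomials,
suitably shifted, nearly coincide on a window of width of order `√N` carrying almost all the weight.
Dimensions: `N.choose n` is `P n / (p^n (1-p)^(N-n))` and `2 ^ e * v.choose m` is `2^(e+v) Q m`. As
`P` and `Q` are comparable, only `2^(e+v)` and the inverse weight matter. The latter is `2^(N E(φ) +
O(√N))` on the window, and the slack `δN` absorbs the error.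

If `δ` exceeds `E - V`, then `e` is cut off at `0` and the slack must come from `E > V`. This is
`entropyGap_pos`, valid unless `p = 1/2`; at `p = 1/2` the two states agree up to phases. If `p` is
`0` or `1`, `φ` is a product state and `E = V = 0`. -/

namespace SSR

/-! ### One-way protocols from incomplete Kraus families -/

/-- The operator `K` changes the local particle number by a fixed integer. -/
def HasShift {A C : LocalSystem} (K : Matrix C.ι A.ι ℂ) : Prop :=
  ∃ Δ : ℤ, ∀ c a, K c a ≠ 0 → (C.num c : ℤ) = (A.num a : ℤ) + Δ

theorem hasShift_zero {A C : LocalSystem} : HasShift (0 : Matrix C.ι A.ι ℂ) :=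
  ⟨0, fun _ _ h => absurd rfl h⟩

theorem hasShift_single {A C : LocalSystem} (c : C.ι) (a : A.ι) (z : ℂ) :
    HasShift (Matrix.single c a z : Matrix C.ι A.ι ℂ) := by
  refine ⟨(C.num c : ℤ) - A.num a, fun c' a' h => ?_⟩
  rw [Matrix.single_apply] at h
  by_cases hc : c = c' ∧ a = a'
  · rw [hc.1, hc.2]; ring
  · simp [hc] at h

theorem SSRLOCC.alice_fintype {A B C A' B' : LocalSystem} {J : Type} [Fintype J]
    (K : J → Matrix C.ι A.ι ℂ) (hK : ∑ j, (K j)ᴴ * K j = 1) (hs : ∀ j, HasShift (K j))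
    (Λ : J → Op C B → Op A' B') (hΛ : ∀ j, SSRLOCC A' B' C B (Λ j)) :
    SSRLOCC A' B' A B (fun ρ => ∑ j, Λ j
      ((K j ⊗ₖ (1 : Matrix B.ι B.ι ℂ)) * ρ * (K j ⊗ₖ (1 : Matrix B.ι B.ι ℂ))ᴴ)) := by
  let e := (Fintype.equivFin J).symm
  have h := SSRLOCC.alice (B := B) (A' := A') (B' := B') (C := fun _ => C) (fun i => K (e i))
    ⟨by rw [← hK]; exact e.sum_comp fun j => (K j)ᴴ * K j, fun i => hs (e i)⟩
    (fun i => Λ (e i)) (fun i => hΛ (e i))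
  convert h using 2 with ρ
  exact (e.sum_comp fun j => Λ j
    ((K j ⊗ₖ (1 : Matrix B.ι B.ι ℂ)) * ρ * (K j ⊗ₖ (1 : Matrix B.ι B.ι ℂ))ᴴ)).symm

theorem SSRLOCC.bob_fintype {A B C A' B' : LocalSystem} {J : Type} [Fintype J]
    (K : J → Matrix C.ι B.ι ℂ) (hK : ∑ j, (K j)ᴴ * K j = 1) (hs : ∀ j, HasShift (K j))
    (Λ : J → Op A C → Op A' B') (hΛ : ∀ j, SSRLOCC A' B' A C (Λ j)) :
    SSRLOCC A' B' A B (fun ρ => ∑ j, Λ j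
      (((1 : Matrix A.ι A.ι ℂ) ⊗ₖ K j) * ρ * ((1 : Matrix A.ι A.ι ℂ) ⊗ₖ K j)ᴴ)) := by
  let e := (Fintype.equivFin J).symm
  have h := SSRLOCC.bob (A := A) (A' := A') (B' := B') (C := fun _ => C) (fun i => K (e i))
    ⟨by rw [← hK]; exact e.sum_comp fun j => (K j)ᴴ * K j, fun i => hs (e i)⟩
    (fun i => Λ (e i)) (fun i => hΛ (e i))
  convert h using 2 with ρ
  exact (e.sum_comp fun j => Λ j
    (((1 : Matrix A.ι A.ι ℂ) ⊗ₖ K j) * ρ * ((1 : Matrix A.ι A.ι ℂ) ⊗ₖ K j)ᴴ)).symm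

/-- Kraus operators completing a family whose sum `∑ Kᴴ K` is `diagonal s`: the basis vector `a` is
replaced by `c` with the remaining weight. -/
noncomputable def complement {A C : LocalSystem} (s : A.ι → ℝ) (c : C.ι) (a : A.ι) : Matrix C.ι A.ι ℂ :=
  Matrix.single c a ((Real.sqrt (1 - s a) : ℝ) : ℂ)

theorem sum_complement {A C : LocalSystem} (s : A.ι → ℝ) (hs : ∀ a, s a ≤ 1) (c : C.ι) :
    ∑ a, (complement s c a : Matrix C.ι A.ι ℂ)ᴴ * complement s c a
      = 1 - Matrix.diagonal fun a => (s a : ℂ) := by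
  have h : ∀ a, (complement s c a : Matrix C.ι A.ι ℂ)ᴴ * complement s c a
      = Matrix.single a a (1 - (s a : ℂ)) := fun a => by
    rw [complement, Matrix.conjTranspose_single, Matrix.single_mul_single_same]
    congr 1
    rw [Complex.star_def, Complex.conj_ofReal, ← Complex.ofReal_mul,
      Real.mul_self_sqrt (sub_nonneg.2 (hs a))]
    simp
  simp_rw [h]
  ext a b
  rw [Matrix.sum_apply, Matrix.sub_apply, Matrix.one_apply, Matrix.diagonal_apply]
  by_cases hab : a = b
  · subst hab
    rw [Finset.sum_eq_single a] <;> simp +contextual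
  · rw [Finset.sum_eq_zero]
    · simp [hab]
    · intro x _
      rw [Matrix.single_apply, if_neg]
      rintro ⟨rfl, h⟩
      exact hab h

theorem sum_elim_complement {A C : LocalSystem} {J : Type} [Fintype J]
    (K : J → Matrix C.ι A.ι ℂ) (s : A.ι → ℝ) (hs : ∀ a, s a ≤ 1) (c : C.ι)
    (hK : ∑ j, (K j)ᴴ * K j = Matrix.diagonal fun a => (s a : ℂ)) :
    ∑ j, (Sum.elim K (complement s c) j)ᴴ * Sum.elim K (complement s c) j = 1 := by
  rw [Fintype.sum_sum_type]
  simp only [Sum.elim_inl, Sum.elim_inr]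
  rw [hK, sum_complement s hs c]
  abel

theorem hasShift_elim_complement {A C : LocalSystem} {J : Type}
    (K : J → Matrix C.ι A.ι ℂ) (h : ∀ j, HasShift (K j)) (s : A.ι → ℝ) (c : C.ι) (j : J ⊕ A.ι) :
    HasShift (Sum.elim K (complement s c) j) := by
  cases j with
  | inl j => exact h j
  | inr a => exact hasShift_single _ _ _

theorem Ket.expect_sum {A B : LocalSystem} {J : Type} (t : Finset J) (ψ : Ket A B)
    (O : J → Op A B) : ψ.expect (∑ j ∈ t, O j) = ∑ j ∈ t, ψ.expect (O j) := by
  simp only [Ket.expect, Matrix.sum_mulVec, dotProduct_sum, Complex.re_sum]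

theorem Ket.expect_conj_proj {A B A' B' : LocalSystem} (φ : Ket A B) (ψ : Ket A' B')
    (M : Matrix (A'.ι × B'.ι) (A.ι × B.ι) ℂ) :
    ψ.expect (M * φ.proj * Mᴴ) = ‖star ψ ⬝ᵥ (M *ᵥ φ)‖ ^ 2 := by
  rw [Ket.expect, Ket.proj, Matrix.mul_vecMulVec, Matrix.vecMulVec_mul, Matrix.vecMulVec_mulVec,
    ← Matrix.star_mulVec]
  rw [op_smul_eq_smul, dotProduct_smul, smul_eq_mul]
  rw [show star (M *ᵥ φ) ⬝ᵥ ψ = star (star ψ ⬝ᵥ (M *ᵥ φ)) by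
    rw [Matrix.star_dotProduct]]
  rw [Complex.star_def, ← Complex.normSq_eq_conj_mul_self, Complex.ofReal_re,
    Complex.normSq_eq_norm_sq]

/-- A one-way protocol: Alice measures `K`, and upon outcome `j` Bob applies `U j`. Diagonal
families that are not complete may be completed by outcomes that count as failures. -/
theorem converts_of_kraus {A B A' B' : LocalSystem} {J : Type} [Fintype J]
    {φ : Ket A B} {ψ : Ket A' B'} {ε : ℝ} (a₀ : A'.ι) (b₀ : B'.ι)
    (K : J → Matrix A'.ι A.ι ℂ) (U : J → Matrix B'.ι B.ι ℂ)
    (hKs : ∀ j, HasShift (K j)) (hUs : ∀ j, HasShift (U j))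
    (s : A.ι → ℝ) (hs : ∀ a, s a ≤ 1)
    (hK : ∑ j, (K j)ᴴ * K j = Matrix.diagonal fun a => (s a : ℂ))
    (t : J → B.ι → ℝ) (ht : ∀ j b, t j b ≤ 1)
    (hU : ∀ j, (U j)ᴴ * U j = Matrix.diagonal fun b => (t j b : ℂ))
    (h : 1 - ε ≤ ∑ j, ‖star ψ ⬝ᵥ ((K j ⊗ₖ U j) *ᵥ φ)‖ ^ 2) : Converts φ ψ ε := by
  -- After a failure of Alice, Bob's intended operator is `0`; its completion consists of failures
  -- only.
  let U' : J ⊕ A.ι → Matrix B'.ι B.ι ℂ := Sum.elim U fun _ => 0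
  let t' : J ⊕ A.ι → B.ι → ℝ := Sum.elim t fun _ => 0
  have ht' : ∀ j b, t' j b ≤ 1 := by
    rintro (j | a) b
    · exact ht j b
    · exact zero_le_one
  have hU' : ∀ j, (U' j)ᴴ * U' j = Matrix.diagonal fun b => (t' j b : ℂ) := by
    rintro (j | a)
    · exact hU j
    · simp [U', t']
  have hUs' : ∀ j, HasShift (U' j) := by
    rintro (j | a)
    · exact hUs j
    · exact hasShift_zero
  let K' : J ⊕ A.ι → Matrix A'.ι A.ι ℂ := Sum.elim K (complement s a₀)
  let W : J ⊕ A.ι → Unit ⊕ B.ι → Matrix B'.ι B.ι ℂ :=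
    fun j => Sum.elim (fun _ => U' j) (complement (t' j) b₀)
  have hΛ := SSRLOCC.alice_fintype K' (sum_elim_complement K s hs a₀ hK)
    (hasShift_elim_complement K hKs s a₀) (B := B) _ fun j =>
      SSRLOCC.bob_fintype (A := A') (W j)
        (sum_elim_complement (fun _ : Unit => U' j) (t' j) (ht' j) b₀ (by simpa using hU' j))
        (hasShift_elim_complement _ (fun _ => hUs' j) _ _) (fun _ ρ => ρ)
        (fun _ => SSRLOCC.done)
  refine ⟨_, hΛ, ?_⟩
  have key : ∀ j i, ψ.expect (((1 : Matrix A'.ι A'.ι ℂ) ⊗ₖ W j i) *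
      ((K' j ⊗ₖ (1 : Matrix B.ι B.ι ℂ)) * φ.proj * (K' j ⊗ₖ (1 : Matrix B.ι B.ι ℂ))ᴴ) *
      ((1 : Matrix A'.ι A'.ι ℂ) ⊗ₖ W j i)ᴴ) = ‖star ψ ⬝ᵥ ((K' j ⊗ₖ W j i) *ᵥ φ)‖ ^ 2 := by
    intro j i
    have hM : K' j ⊗ₖ W j i
        = ((1 : Matrix A'.ι A'.ι ℂ) ⊗ₖ W j i) * (K' j ⊗ₖ (1 : Matrix B.ι B.ι ℂ)) := by
      rw [← Matrix.mul_kronecker_mul, Matrix.one_mul, Matrix.mul_one]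
    rw [hM, ← Ket.expect_conj_proj, Matrix.conjTranspose_mul]
    simp only [Matrix.mul_assoc]
  have total : ψ.expect (∑ j, ∑ i, ((1 : Matrix A'.ι A'.ι ℂ) ⊗ₖ W j i) *
      ((K' j ⊗ₖ (1 : Matrix B.ι B.ι ℂ)) * φ.proj * (K' j ⊗ₖ (1 : Matrix B.ι B.ι ℂ))ᴴ) *
      ((1 : Matrix A'.ι A'.ι ℂ) ⊗ₖ W j i)ᴴ)
      = ∑ j, ∑ i, ‖star ψ ⬝ᵥ ((K' j ⊗ₖ W j i) *ᵥ φ)‖ ^ 2 := by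
    rw [Ket.expect_sum]
    refine Finset.sum_congr rfl fun j _ => ?_
    rw [Ket.expect_sum]
    exact Finset.sum_congr rfl fun i _ => key j i
  refine h.trans (le_trans ?_ total.ge)
  -- Failure outcomes contribute nonnegative fidelity, so they may be dropped from the lower bound.
  have hsplit : ∀ j, ‖star ψ ⬝ᵥ ((K j ⊗ₖ U j) *ᵥ φ)‖ ^ 2
      ≤ ∑ i, ‖star ψ ⬝ᵥ ((K' (Sum.inl j) ⊗ₖ W (Sum.inl j) i) *ᵥ φ)‖ ^ 2 := fun j => by
    rw [Fintype.sum_sum_type, Fintype.sum_unique]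
    exact le_add_of_nonneg_right (Finset.sum_nonneg fun i _ => sq_nonneg _)
  rw [Fintype.sum_sum_type]
  exact le_add_of_le_of_nonneg (Finset.sum_le_sum fun j _ => hsplit j)
    (Finset.sum_nonneg fun a _ => Finset.sum_nonneg fun i _ => sq_nonneg _)

/-! ### Pairing operators and label-preserving permutations -/

/-- The operator `∑ t, z t |f t⟩⟨g t|`. -/
noncomputable def pairing {T C A : Type} [Fintype T] [DecidableEq C] [DecidableEq A]
    (f : T → C) (g : T → A) (z : T → ℂ) : Matrix C A ℂ :=
  ∑ t, Matrix.single (f t) (g t) (z t)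

theorem pairing_conjTranspose_mul {T C A : Type} [Fintype T] [Fintype C] [Fintype A]
    [DecidableEq C] [DecidableEq A] {f : T → C} (hf : Function.Injective f) (g : T → A)
    (z : T → ℂ) :
    (pairing f g z)ᴴ * pairing f g z
      = Matrix.diagonal fun a => ((∑ t, if g t = a then ‖z t‖ ^ 2 else 0 : ℝ) : ℂ) := by
  have h : ∀ t, ∑ t', Matrix.single (g t) (f t) (star (z t)) * Matrix.single (f t') (g t') (z t')
      = Matrix.single (g t) (g t) ((‖z t‖ ^ 2 : ℝ) : ℂ) := fun t => by
    rw [Finset.sum_eq_single t]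
    · rw [Matrix.single_mul_single_same, Complex.star_def, ← Complex.normSq_eq_conj_mul_self,
        Complex.normSq_eq_norm_sq]
    · intro t' _ ht
      exact Matrix.single_mul_single_of_ne _ _ _ _ (fun h => ht (hf h).symm) _
    · simp
  rw [pairing, Matrix.conjTranspose_sum, Matrix.sum_mul]
  simp only [Matrix.conjTranspose_single, Matrix.mul_sum, h]
  ext a b
  rw [Matrix.sum_apply, Matrix.diagonal_apply]
  split_ifs with hab
  · subst hab
    rw [Complex.ofReal_sum]
    refine Finset.sum_congr rfl fun t _ => ?_
    by_cases hg : g t = a <;> simp [hg]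
  · refine Finset.sum_eq_zero fun t _ => ?_
    rw [Matrix.single_apply, if_neg]
    rintro ⟨rfl, h⟩
    exact hab h

theorem hasShift_pairing {T : Type} [Fintype T] {A C : LocalSystem} (f : T → C.ι) (g : T → A.ι)
    (z : T → ℂ) (Δ : ℤ) (h : ∀ t, (C.num (f t) : ℤ) = A.num (g t) + Δ) :
    HasShift (pairing f g z) := by
  refine ⟨Δ, fun c a hca => ?_⟩
  rw [pairing, Matrix.sum_apply] at hca
  obtain ⟨t, -, ht⟩ := Finset.exists_ne_zero_of_sum_ne_zero hca
  rw [Matrix.single_apply] at ht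
  by_cases hc : f t = c ∧ g t = a
  · rw [← hc.1, ← hc.2, h t]
  · simp [hc] at ht

theorem sum_mul_pairing {T C A : Type} [Fintype T] [Fintype C] [Fintype A] [DecidableEq C]
    [DecidableEq A] (f : T → C) (g : T → A) (z : T → ℂ) (F : C → A → ℂ) :
    ∑ c, ∑ a, F c a * pairing f g z c a = ∑ t, F (f t) (g t) * z t := by
  simp only [pairing, Matrix.sum_apply, Finset.mul_sum]
  rw [Finset.sum_congr rfl fun c _ => Finset.sum_comm, Finset.sum_comm]
  refine Finset.sum_congr rfl fun t _ => ?_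
  rw [Finset.sum_eq_single (f t), Finset.sum_eq_single (g t)]
  · simp
  · intro a _ ha
    simp [ha.symm]
  · simp
  · intro c _ hc
    simp [hc.symm]
  · simp

theorem dotProduct_pairing_kronecker {T : Type} [Fintype T] {A B A' B' : LocalSystem}
    (φ : Ket A B) (ψ : Ket A' B') (f : T → A'.ι) (g : T → A.ι) (z : T → ℂ)
    (f' : T → B'.ι) (g' : T → B.ι) (z' : T → ℂ) :
    star ψ ⬝ᵥ ((pairing f g z ⊗ₖ pairing f' g' z') *ᵥ φ)
      = ∑ t, ∑ t', star (ψ (f t, f' t')) * φ (g t, g' t') * z' t' * z t := by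
  have h : star ψ ⬝ᵥ ((pairing f g z ⊗ₖ pairing f' g' z') *ᵥ φ)
      = ∑ c, ∑ a, (∑ d, ∑ b, (star (ψ (c, d)) * φ (a, b)) * pairing f' g' z' d b)
          * pairing f g z c a := by
    simp only [dotProduct, Matrix.mulVec, Fintype.sum_prod_type, Matrix.kroneckerMap_apply,
      Finset.mul_sum, Finset.sum_mul, Pi.star_apply]
    refine Finset.sum_congr rfl fun c _ => ?_
    rw [Finset.sum_comm]
    refine Finset.sum_congr rfl fun a _ => Finset.sum_congr rfl fun d _ =>
      Finset.sum_congr rfl fun b _ => ?_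
    ring
  rw [h, sum_mul_pairing f g z fun c a =>
    ∑ d, ∑ b, (star (ψ (c, d)) * φ (a, b)) * pairing f' g' z' d b]
  refine Finset.sum_congr rfl fun t _ => ?_
  rw [sum_mul_pairing f' g' z' fun d b => star (ψ (f t, d)) * φ (g t, b), Finset.sum_mul]

/-- The permutations that preserve a labelling. -/
abbrev LabelPerm {X : Type} (s : X → ℕ) : Type := {σ : Equiv.Perm X // ∀ x, s (σ x) = s x}

-- Composing with the transposition of `y` and `z` matches the permutations sending `x` to `y` with
-- those sending `x` to `z`, so the images of `x` are equidistributed over its block.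
open Classical in
theorem card_labelPerm_apply_eq {X : Type} [Fintype X] (s : X → ℕ) {x y : X} (h : s x = s y) :
    (Finset.univ.filter fun σ : LabelPerm s => σ.1 x = y).card * Fintype.card {z // s z = s x}
      = Fintype.card (LabelPerm s) := by
  have hcount : ∀ z : {z // s z = s x},
      (Finset.univ.filter fun σ : LabelPerm s => σ.1 x = z).card
        = (Finset.univ.filter fun σ : LabelPerm s => σ.1 x = y).card := by
    rintro ⟨z, hz⟩
    have hswap : ∀ w, s (Equiv.swap y z w) = s w := fun w => by
      rcases eq_or_ne w y with rfl | hy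
      · rw [Equiv.swap_apply_left, hz, h]
      · rcases eq_or_ne w z with rfl | hw
        · rw [Equiv.swap_apply_right, hz, h]
        · rw [Equiv.swap_apply_of_ne_of_ne hy hw]
    refine Finset.card_nbij' (fun σ => ⟨Equiv.swap y z * σ.1, fun w => by
        rw [Equiv.Perm.mul_apply, hswap, σ.2]⟩) (fun σ => ⟨Equiv.swap y z * σ.1, fun w => by
        rw [Equiv.Perm.mul_apply, hswap, σ.2]⟩) ?_ ?_ ?_ ?_
    · intro σ hσ
      have : σ.1 x = z := by simpa using hσ
      simp [this]
    · intro σ hσ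
      have : σ.1 x = y := by simpa using hσ
      simp [this]
    · intro σ _
      ext w
      simp
    · intro σ _
      ext w
      simp
  have hfib := Finset.card_eq_sum_card_fiberwise
    (f := fun σ : LabelPerm s => (⟨σ.1 x, σ.2 x⟩ : {z // s z = s x}))
    (s := Finset.univ) (t := Finset.univ) (fun _ _ => Finset.mem_coe.2 (Finset.mem_univ _))
  rw [← Finset.card_univ (α := LabelPerm s), hfib]
  rw [Finset.sum_congr rfl fun z _ => (by
    rw [← hcount z]; congr 1; ext σ; simp [Subtype.ext_iff] :
    _ = (Finset.univ.filter fun σ : LabelPerm s => σ.1 x = y).card)]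
  rw [Finset.sum_const, Finset.card_univ, smul_eq_mul, mul_comm]

/-! ### Block states and conversions between them -/

/-- A vector whose Schmidt basis consists of basis vectors `α x ⊗ β x` of definite local particle
numbers, with the modulus of the Schmidt coefficients depending only on the label `s x`, which is
Alice's particle number up to an additive constant. -/
def IsBlockState {A B : LocalSystem} (φ : Ket A B) {X : Type} (s : X → ℕ) (f : ℕ → ℝ) : Prop :=
  ∃ (α : X ↪ A.ι) (β : X ↪ B.ι),
    (∃ k : ℤ, ∀ x, (A.num (α x) : ℤ) = s x + k) ∧
    (∃ k : ℤ, ∀ x, (B.num (β x) : ℤ) = k - s x) ∧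
    (∀ a b, φ (a, b) ≠ 0 → ∃ x, α x = a ∧ β x = b) ∧
    ∀ x, ‖φ (α x, β x)‖ ^ 2 = f (s x)

/-- The number of elements with a given label. -/
noncomputable def blockCard {X : Type} (s : X → ℕ) (n : ℕ) : ℕ := Nat.card {x // s x = n}

/-- The phase of a complex number, with the phase of `0` being `1`. -/
noncomputable def phase (c : ℂ) : ℂ := if c = 0 then 1 else c / ‖c‖

theorem norm_phase (c : ℂ) : ‖phase c‖ = 1 := by
  unfold phase
  split_ifs with h
  · simp
  · rw [norm_div, Complex.norm_real, norm_norm, div_self (norm_ne_zero_iff.2 h)]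

theorem star_phase_mul (c : ℂ) : star (phase c) * c = ‖c‖ := by
  unfold phase
  split_ifs with h
  · simp [h]
  · have : (‖c‖ : ℂ) ≠ 0 := by exact_mod_cast norm_ne_zero_iff.2 h
    rw [star_div₀, div_mul_eq_mul_div, Complex.star_def, ← Complex.normSq_eq_conj_mul_self,
      Complex.conj_ofReal, Complex.normSq_eq_norm_sq]
    field_simp
    push_cast
    ring

theorem star_mul_phase (c : ℂ) : star c * phase c = ‖c‖ := by
  have h := congrArg star (star_phase_mul c)
  rw [star_mul, star_star, Complex.star_def, Complex.conj_ofReal] at h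
  rw [Complex.star_def, h]

theorem sum_ite_apply_eq_le_one {T A : Type} [Fintype T] [DecidableEq A] {g : T → A}
    (hg : Function.Injective g) (a : A) : (∑ t, if g t = a then (1 : ℝ) else 0) ≤ 1 := by
  rw [Finset.sum_boole]
  norm_cast
  refine Finset.card_le_one.2 fun t ht t' ht' => hg ?_
  rw [(Finset.mem_filter.1 ht).2, (Finset.mem_filter.1 ht').2]

-- With these weights, averaging over the permutations spreads each `x` evenly over its block.
-- Summing over `D` many `x` from one block then gives the projection onto it, which is the
-- completeness relation for Alice's measurement.
open Classical in
theorem sum_labelPerm_ite {X : Type} [Fintype X] (s : X → ℕ) (x x₀ : X) (D : ℝ) :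
    (∑ σ : LabelPerm s, if σ.1 x = x₀ then
      ((blockCard s (s x) : ℝ) / (D * Fintype.card (LabelPerm s))) else 0)
      = if s x = s x₀ then 1 / D else 0 := by
  rw [← Finset.sum_filter, Finset.sum_const, nsmul_eq_mul]
  split_ifs with h
  · have hc := card_labelPerm_apply_eq s h
    rw [← Nat.card_eq_fintype_card (α := {z // s z = s x})] at hc
    have hL : (Fintype.card (LabelPerm s) : ℝ) ≠ 0 := by
      have : Nonempty (LabelPerm s) := ⟨⟨1, fun _ => rfl⟩⟩
      exact_mod_cast Fintype.card_ne_zero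
    rw [blockCard, ← mul_div_assoc, ← Nat.cast_mul, hc, mul_comm D, ← div_div, div_self hL]
  · rw [Finset.filter_false_of_mem, Finset.card_empty, Nat.cast_zero, zero_mul]
    rintro σ - rfl
    exact h (σ.2 x).symm

/-- Between block states, Alice and Bob can shrink the maximally entangled state within each block
coherently. The fidelity is then limited by the overlap of the distributions of the label. -/
theorem converts_of_blocks {A B A' B' : LocalSystem} {φ : Ket A B} {ψ : Ket A' B'} {ε : ℝ}
    {X Y : Type} [Fintype X] [Fintype Y] [Nonempty Y] {s : X → ℕ} {s' : Y → ℕ} {f g : ℕ → ℝ}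
    (hφ : IsBlockState φ s f) (hψ : IsBlockState ψ s' g) (n₁ m₁ : ℕ) (Z : Finset ℕ)
    (hcard : ∀ k ∈ Z, blockCard s' (m₁ + k) ≤ blockCard s (n₁ + k))
    (h : 1 - ε ≤ (∑ k ∈ Z, √((blockCard s (n₁ + k) * f (n₁ + k)) *
      (blockCard s' (m₁ + k) * g (m₁ + k)))) ^ 2) : Converts φ ψ ε := by
  classical
  obtain ⟨α, β, ⟨kA, hA⟩, ⟨kB, hB⟩, -, hf⟩ := hφ
  obtain ⟨α', β', ⟨kA', hA'⟩, ⟨kB', hB'⟩, hsupp, hg⟩ := hψ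
  have he : ∀ k : Z, Nonempty ({y // s' y = m₁ + k} ↪ {x // s x = n₁ + k}) := fun k => by
    refine Function.Embedding.nonempty_of_card_le ?_
    have := hcard k k.2
    rwa [blockCard, blockCard, Nat.card_eq_fintype_card, Nat.card_eq_fintype_card] at this
  let e := fun k => (he k).some
  -- `T` runs over the target Schmidt vectors in the blocks of `Z`; `x` embeds each target block
  -- into the corresponding source block. Outcome `σ` first moves this embedded copy by `σ`.
  let T := Σ k : Z, {y // s' y = m₁ + k}
  let x : T → X := fun t => (e t.1 t.2).1
  let y : T → Y := fun t => t.2.1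
  have hx : ∀ t, s (x t) = n₁ + t.1 := fun t => (e t.1 t.2).2
  have hy : ∀ t, s' (y t) = m₁ + t.1 := fun t => t.2.2
  have hyinj : Function.Injective y := by
    rintro ⟨k, u, hu⟩ ⟨k', u', hu'⟩ (huu : u = u')
    subst huu
    obtain rfl : k = k' := Subtype.ext (by omega)
    rfl
  have hxinj : Function.Injective x := by
    rintro t t' htt
    have h1 := hx t
    have h2 := hx t'
    obtain ⟨k, u⟩ := t
    obtain ⟨k', u'⟩ := t'
    obtain rfl : k = k' := Subtype.ext (by rw [htt] at h1; simp only at h1 h2; omega)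
    obtain rfl : u = u' := (e k).injective (Subtype.ext htt)
    rfl
  let L : ℝ := Fintype.card (LabelPerm s)
  have hL : 0 < L := by
    have : Nonempty (LabelPerm s) := ⟨⟨1, fun _ => rfl⟩⟩
    exact Nat.cast_pos.2 Fintype.card_pos
  -- The ratio of block dimensions compensates for the loss in shrinking, separately in each block;
  -- `1 / L` shares the total among the outcomes.
  let w : T → ℝ := fun t => √((blockCard s (s (x t)) : ℝ) / (blockCard s' (m₁ + t.1) * L))
  have hw : ∀ t, w t ^ 2 = (blockCard s (s (x t)) : ℝ) / (blockCard s' (m₁ + t.1) * L) := fun t =>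
    Real.sq_sqrt (by positivity)
  -- The phases turn every term of the amplitude into a nonnegative real, so that the blocks
  -- interfere constructively.
  let z : LabelPerm s → T → ℂ := fun σ t => (w t : ℂ) *
    (phase (ψ (α' (y t), β' (y t))) * star (phase (φ (α (σ.1 (x t)), β (σ.1 (x t))))))
  have hz : ∀ σ t, ‖z σ t‖ ^ 2 = w t ^ 2 := fun σ t => by
    rw [norm_mul, norm_mul, norm_star, norm_phase, norm_phase, Complex.norm_real, mul_one, mul_one,
      Real.norm_eq_abs, sq_abs]
  let y₀ : Y := Classical.arbitrary Y
  refine converts_of_kraus (J := LabelPerm s) (α' y₀) (β' y₀)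
    (fun σ => pairing (fun t => α' (y t)) (fun t => α (σ.1 (x t))) (z σ))
    (fun σ => pairing (fun t => β' (y t)) (fun t => β (σ.1 (x t))) fun _ => 1)
    (fun σ => hasShift_pairing _ _ _ (m₁ + kA' - n₁ - kA) fun t => ?_)
    (fun σ => hasShift_pairing _ _ _ (kB' - m₁ - kB + n₁) fun t => ?_)
    (fun a => ∑ σ : LabelPerm s, ∑ t, if α (σ.1 (x t)) = a then ‖z σ t‖ ^ 2 else 0) (fun a => ?_) ?_
    (fun σ b => ∑ t, if β (σ.1 (x t)) = b then ‖(1 : ℂ)‖ ^ 2 else 0) (fun σ b => ?_)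
    (fun σ => pairing_conjTranspose_mul (β'.injective.comp hyinj) _ _) (h.trans ?_)
  · rw [hA, hA', σ.2, hx, hy]; push_cast; ring
  · rw [hB, hB', σ.2, hx, hy]; push_cast; ring
  · simp only [hz]
    by_cases ha : ∃ x₀, α x₀ = a
    · obtain ⟨x₀, rfl⟩ := ha
      simp only [α.injective.eq_iff]
      rw [Finset.sum_comm]
      simp only [hw]
      rw [Finset.sum_congr rfl fun t _ => sum_labelPerm_ite s (x t) x₀ _]
      rw [Fintype.sum_sigma]
      -- Only the block containing `x₀` contributes: its `D` terms `1 / D` sum to `1`, or to `0` if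
      -- the target block is empty.
      calc _ ≤ ∑ k : Z, if n₁ + (k : ℕ) = s x₀ then (1 : ℝ) else 0 := by
            refine Finset.sum_le_sum fun k _ => ?_
            simp only [hx]
            split_ifs
            · rw [Finset.sum_const, nsmul_eq_mul, mul_one_div, Finset.card_univ, blockCard,
                Nat.card_eq_fintype_card]
              exact div_self_le_one _
            · simp
        _ ≤ 1 := sum_ite_apply_eq_le_one (g := fun k : Z => n₁ + (k : ℕ))
            (fun k k' hk => Subtype.ext (Nat.add_left_cancel hk)) (s x₀)
    · rw [Finset.sum_eq_zero]
      · exact zero_le_one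
      · intro σ _
        exact Finset.sum_eq_zero fun t _ => if_neg fun h => ha ⟨_, h⟩
  · refine (Finset.sum_congr rfl fun σ _ => pairing_conjTranspose_mul
      (α'.injective.comp hyinj) _ _).trans ?_
    ext a b
    rw [Matrix.sum_apply, Matrix.diagonal_apply]
    by_cases hab : a = b
    · simp [hab]
    · simp [hab]
  · simp only [norm_one, one_pow]
    exact sum_ite_apply_eq_le_one
      (β.injective.comp (σ.1.injective.comp hxinj) : Function.Injective fun t => β (σ.1 (x t))) b
  · set S := ∑ k ∈ Z, √((blockCard s (n₁ + k) * f (n₁ + k)) *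
      (blockCard s' (m₁ + k) * g (m₁ + k))) with hS
    -- All outcomes have the same amplitude `S / √L`, and there are `L` of them, so the total
    -- fidelity is `S ^ 2`.
    have hamp : ∀ σ : LabelPerm s, star ψ ⬝ᵥ
        ((pairing (fun t => α' (y t)) (fun t => α (σ.1 (x t))) (z σ) ⊗ₖ
          pairing (fun t => β' (y t)) (fun t => β (σ.1 (x t))) fun _ => 1) *ᵥ φ)
        = ((S / √L : ℝ) : ℂ) := fun σ => by
      rw [dotProduct_pairing_kronecker]
      have hterm : ∀ t, ∑ t', star (ψ (α' (y t), β' (y t'))) *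
          φ (α (σ.1 (x t)), β (σ.1 (x t'))) * 1 * z σ t
          = ((√(g (m₁ + t.1)) * √(f (n₁ + t.1)) * w t : ℝ) : ℂ) := fun t => by
        rw [Finset.sum_eq_single t]
        · have h1 : ‖ψ (α' (y t), β' (y t))‖ = √(g (m₁ + t.1)) := by
            rw [← hy, ← hg, Real.sqrt_sq (norm_nonneg _)]
          have h2 : ‖φ (α (σ.1 (x t)), β (σ.1 (x t)))‖ = √(f (n₁ + t.1)) := by
            rw [← hx, ← σ.2, ← hf, Real.sqrt_sq (norm_nonneg _)]
          rw [← h1, ← h2]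
          push_cast
          rw [← star_mul_phase, ← star_phase_mul]
          simp only [z]
          ring
        -- The off-diagonal terms vanish because `ψ` is supported on its matched Schmidt pairs.
        · intro t' _ ht'
          have : ψ (α' (y t), β' (y t')) = 0 := by
            by_contra hne
            obtain ⟨u, hu, hu'⟩ := hsupp _ _ hne
            exact ht' (hyinj ((β'.injective hu').symm.trans (α'.injective hu)))
          simp [this]
        · simp
      rw [Finset.sum_congr rfl fun t _ => hterm t, ← Complex.ofReal_sum, Fintype.sum_sigma]
      congr 1
      rw [hS, Finset.sum_div, ← Finset.sum_coe_sort Z]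
      refine Finset.sum_congr rfl fun k _ => ?_
      have hD : (0 : ℝ) ≤ blockCard s' (m₁ + k) := Nat.cast_nonneg _
      have hd : (0 : ℝ) ≤ blockCard s (n₁ + k) := Nat.cast_nonneg _
      simp only [w, hx]
      rw [Finset.sum_const, nsmul_eq_mul, Finset.card_univ, ← Nat.card_eq_fintype_card, ← blockCard]
      rcases hD.eq_or_lt with h0 | h0
      · simp [← h0]
      · have hg0 : 0 ≤ g (m₁ + k) := by
          obtain ⟨u, hu⟩ := (Nat.card_pos_iff.1 (Nat.cast_pos.1 h0)).1
          rw [← hu, ← hg]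
          exact sq_nonneg _
        rw [mul_mul_mul_comm, Real.sqrt_mul (mul_nonneg hd hD), Real.sqrt_div hd,
          Real.sqrt_mul hD, Real.sqrt_mul hd, Real.sqrt_mul' _ hg0]
        have : √(blockCard s' (m₁ + k) : ℝ) ≠ 0 := (Real.sqrt_pos.2 h0).ne'
        have hL' : √L ≠ 0 := (Real.sqrt_pos.2 hL).ne'
        nth_rewrite 1 [← Real.mul_self_sqrt hD]
        field_simp
    simp only [hamp]
    rw [Finset.sum_const, nsmul_eq_mul, Finset.card_univ, Complex.norm_real, Real.norm_eq_abs,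
      sq_abs, div_pow, Real.sq_sqrt hL.le]
    exact (mul_div_cancel₀ _ hL.ne').ge

/-! ### Block structure of the states in question -/

/-- A factor without number fluctuations only multiplies the block dimensions. -/
theorem IsBlockState.tensor {A₁ B₁ A₂ B₂ : LocalSystem} {φ₁ : Ket A₁ B₁} {φ₂ : Ket A₂ B₂}
    {X₁ X₂ : Type} {s : X₂ → ℕ} {f₁ f₂ : ℕ → ℝ} (h₁ : IsBlockState φ₁ (fun _ : X₁ => 0) f₁)
    (h₂ : IsBlockState φ₂ s f₂) :
    IsBlockState (φ₁.tensor φ₂) (fun x : X₁ × X₂ => s x.2) (fun n => f₁ 0 * f₂ n) := by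
  obtain ⟨α₁, β₁, ⟨kA₁, hA₁⟩, ⟨kB₁, hB₁⟩, hs₁, hf₁⟩ := h₁
  obtain ⟨α₂, β₂, ⟨kA₂, hA₂⟩, ⟨kB₂, hB₂⟩, hs₂, hf₂⟩ := h₂
  refine ⟨α₁.prodMap α₂, β₁.prodMap β₂, ⟨kA₁ + kA₂, fun x => ?_⟩, ⟨kB₁ + kB₂, fun x => ?_⟩,
    ?_, fun x => ?_⟩
  · have h1 := hA₁ x.1
    have h2 := hA₂ x.2
    simp only [Function.Embedding.coe_prodMap, Prod.map]
    push_cast at *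
    linarith
  · have h1 := hB₁ x.1
    have h2 := hB₂ x.2
    simp only [Function.Embedding.coe_prodMap, Prod.map]
    push_cast at *
    linarith
  · rintro ⟨a₁, a₂⟩ ⟨b₁, b₂⟩ h
    obtain ⟨x₁, rfl, rfl⟩ := hs₁ a₁ b₁ (left_ne_zero_of_mul h)
    obtain ⟨x₂, rfl, rfl⟩ := hs₂ a₂ b₂ (right_ne_zero_of_mul h)
    exact ⟨(x₁, x₂), rfl, rfl⟩
  · simp only
    rw [← hf₁ x.1, ← hf₂ x.2, ← mul_pow, ← norm_mul]
    rfl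

theorem IsBlockState.of_injective {A B : LocalSystem} {φ : Ket A B} {X : Type} {s : X → ℕ}
    {f : ℕ → ℝ} (α : X → A.ι) (β : X → B.ι) (kA kB : ℤ) (hα : Function.Injective α)
    (hβ : Function.Injective β) (hA : ∀ x, (A.num (α x) : ℤ) = s x + kA)
    (hB : ∀ x, (B.num (β x) : ℤ) = kB - s x)
    (hφ : ∀ a b, φ (a, b) ≠ 0 → ∃ x, α x = a ∧ β x = b)
    (hf : ∀ x, ‖φ (α x, β x)‖ ^ 2 = f (s x)) : IsBlockState φ s f :=
  ⟨⟨α, hα⟩, ⟨β, hβ⟩, ⟨kA, hA⟩, ⟨kB, hB⟩, hφ, hf⟩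

theorem isBlockState_pow_unit {A B : LocalSystem} {φ : Ket A B} {a₀ : A.ι} {b₀ : B.ι}
    (h₀ : ‖φ (a₀, b₀)‖ = 1) (h : ∀ a b, φ (a, b) ≠ 0 → a = a₀ ∧ b = b₀) (N : ℕ) :
    IsBlockState (φ.pow N) (fun _ : Unit => 0) (fun _ => 1) := by
  refine .of_injective (fun _ _ => a₀) (fun _ _ => b₀) ((A.pow N).num fun _ => a₀)
    ((B.pow N).num fun _ => b₀) (fun _ _ _ => rfl) (fun _ _ _ => rfl) (fun _ => by simp)
    (fun _ => by simp) (fun a b hab => ⟨(), ?_⟩) (fun _ => ?_)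
  · have hk : ∀ k, a k = a₀ ∧ b k = b₀ := fun k => h _ _ (Finset.prod_ne_zero_iff.1 hab k
      (Finset.mem_univ k))
    exact ⟨funext fun k => (hk k).1.symm, funext fun k => (hk k).2.symm⟩
  · simp [Ket.pow, h₀]

/-- Alice holds exactly one particle per E-EPR pair, so there is a single block, of dimension `2 ^
e`. -/
theorem isBlockState_eEPR_pow (e : ℕ) :
    IsBlockState (eEPR.pow e) (fun _ : Fin e → Fin 2 => 0) (fun _ => (1 / 2) ^ e) := by
  refine .of_injective (fun x k => (x k, 1 - x k)) (fun x k => (1 - x k, x k)) e e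
    (fun x y h => funext fun k => congrArg Prod.fst (congrFun h k))
    (fun x y h => funext fun k => congrArg Prod.snd (congrFun h k))
    (fun x => ?_) (fun x => ?_) (fun a b hab => ⟨fun k => (a k).1, ?_⟩) (fun x => ?_)
  · have : ∀ i : Fin 2, (i : ℤ) + ((1 - i : Fin 2) : ℤ) = 1 := by decide
    simp [this]
  · have : ∀ i : Fin 2, ((1 - i : Fin 2) : ℤ) + (i : ℤ) = 1 := by decide
    simp [this]
  · have hk : ∀ k, (a k, b k) = ((0, 1), (1, 0)) ∨ (a k, b k) = ((1, 0), (0, 1)) := fun k => by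
      by_contra hne
      exact Finset.prod_ne_zero_iff.1 hab k (Finset.mem_univ k) (if_neg hne)
    constructor <;> funext k <;> rcases hk k with h | h <;>
      · obtain ⟨h1, h2⟩ := Prod.ext_iff.1 h
        simp only at h1 h2
        simp [h1, h2]
  · have hx : ∀ i : Fin 2, ‖eEPR ((i, 1 - i), (1 - i, i))‖ ^ 2 = 1 / 2 := by
      intro i
      fin_cases i <;> simp [eEPR]
    simp only [Ket.pow, norm_prod, ← Finset.prod_pow, hx]
    simp

/-- The Schmidt basis is indexed by the set of copies in which Alice holds the particle. -/
theorem isBlockState_pow {φ : Ket qubit qubit} {p : ℝ} (h00 : φ (0, 0) = 0) (h11 : φ (1, 1) = 0)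
    (h10 : ‖φ (1, 0)‖ ^ 2 = p) (h01 : ‖φ (0, 1)‖ ^ 2 = 1 - p) (N : ℕ) :
    IsBlockState (φ.pow N) (Finset.card : Finset (Fin N) → ℕ)
      (fun n => p ^ n * (1 - p) ^ (N - n)) := by
  have hnot : ∀ S : Finset (Fin N), (Finset.univ.filter fun k => k ∉ S).card = N - S.card :=
    fun S => by rw [← Finset.compl_filter, Finset.filter_univ_mem, Finset.card_compl,
      Fintype.card_fin]
  refine .of_injective (fun S k => if k ∈ S then 1 else 0) (fun S k => if k ∈ S then 0 else 1) 0 N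
    (fun S S' h => Finset.ext fun k => ?_) (fun S S' h => Finset.ext fun k => ?_)
    (fun S => ?_) (fun S => ?_) (fun a b hab => ⟨Finset.univ.filter fun k => a k = 1, ?_⟩)
    (fun S => ?_)
  · have := congrFun h k
    by_cases h1 : k ∈ S <;> by_cases h2 : k ∈ S' <;> simp_all
  · have := congrFun h k
    by_cases h1 : k ∈ S <;> by_cases h2 : k ∈ S' <;> simp_all
  · have : ∀ k, (((if k ∈ S then 1 else 0 : Fin 2) : ℕ) : ℤ) = if k ∈ S then 1 else 0 := fun k => by
      split_ifs <;> rfl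
    simp [this]
  · have : ∀ k, (((if k ∈ S then 0 else 1 : Fin 2) : ℕ) : ℤ) = if k ∉ S then 1 else 0 := fun k => by
      by_cases h : k ∈ S <;> simp [h]
    have hS : S.card ≤ N := by simpa using S.card_le_univ
    rw [Nat.cast_sum, Finset.sum_congr rfl fun k _ => this k, Finset.sum_boole, hnot,
      Nat.cast_sub hS]
  · have hk : ∀ k, φ (a k, b k) ≠ 0 := fun k =>
      Finset.prod_ne_zero_iff.1 hab k (Finset.mem_univ k)
    have hq : ∀ i j : Fin 2, φ (i, j) ≠ 0 → (i = 0 ∧ j = 1) ∨ (i = 1 ∧ j = 0) := by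
      intro i j
      fin_cases i <;> fin_cases j <;> simp [h00, h11]
    constructor <;> funext k <;> rcases hq _ _ (hk k) with ⟨h1, h2⟩ | ⟨h1, h2⟩ <;> simp [h1, h2]
  · have hS : ∀ k, ‖φ ((if k ∈ S then 1 else 0), (if k ∈ S then 0 else 1))‖ ^ 2
        = if k ∈ S then p else 1 - p := fun k => by
      split_ifs
      · exact h10
      · exact h01
    simp only [Ket.pow, norm_prod, ← Finset.prod_pow, hS]
    rw [Finset.prod_ite, Finset.prod_const, Finset.prod_const, hnot, Finset.filter_univ_mem]

/-- The probability of `n` successes in `N` independent trials. -/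
noncomputable def binomialProb (N : ℕ) (p : ℝ) (n : ℕ) : ℝ :=
  N.choose n * (p ^ n * (1 - p) ^ (N - n))

theorem isBlockState_epr (e v : ℕ) :
    IsBlockState ((eEPR.pow e).tensor (vEPR.pow v))
      (fun y : (Fin e → Fin 2) × Finset (Fin v) => y.2.card)
      (fun m => (1 / 2) ^ e * ((1 / 2) ^ m * (1 - 1 / 2) ^ (v - m))) :=
  (isBlockState_eEPR_pow e).tensor
    (isBlockState_pow (by simp [vEPR]) (by simp [vEPR]) (by simp [vEPR])
      (by norm_num [vEPR]) v)

theorem blockCard_card (N n : ℕ) : blockCard (Finset.card : Finset (Fin N) → ℕ) n = N.choose n := by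
  rw [blockCard, Nat.card_eq_fintype_card, Fintype.card_finset_len, Fintype.card_fin]

theorem blockCard_prod {X Y : Type} (s : Y → ℕ) (n : ℕ) :
    blockCard (fun x : X × Y => s x.2) n = Nat.card X * blockCard s n := by
  rw [blockCard, blockCard, ← Nat.card_prod]
  exact Nat.card_congr 
    { toFun := fun x => (x.1.1, ⟨x.1.2, x.2⟩)
      invFun := fun x => ⟨(x.1, x.2.1), x.2.2⟩
      left_inv := fun _ => rfl
      right_inv := fun _ => rfl }

theorem blockCard_epr (e v m : ℕ) :
    blockCard (fun y : (Fin e → Fin 2) × Finset (Fin v) => y.2.card) m = 2 ^ e * v.choose m := by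
  rw [blockCard_prod, blockCard_card]
  simp

/-! ### Entanglement and variance of a two-qubit state -/

/-- Eigenvalues and diagonal entries agree only as multisets, namely as roots of the characteristic
polynomial. -/
theorem sum_eigenvalues_of_eq_diagonal {ι : Type} [Fintype ι] [DecidableEq ι] {M : Matrix ι ι ℂ}
    (hM : M.IsHermitian) (d : ι → ℝ) (h : M = Matrix.diagonal fun i => (d i : ℂ)) (F : ℝ → ℝ) :
    ∑ i, F (hM.eigenvalues i) = ∑ i, F (d i) := by
  have h1 := hM.roots_charpoly_eq_eigenvalues
  have h2 : M.charpoly.roots = Multiset.map (fun i => (d i : ℂ)) Finset.univ.val := by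
    rw [h, Matrix.charpoly_diagonal, Polynomial.roots_prod]
    · simp
    · simp [Finset.prod_ne_zero_iff, Polynomial.X_sub_C_ne_zero]
  rw [h2] at h1
  have h3 := congrArg (fun s => (s.map fun z : ℂ => F z.re).sum) h1
  simpa [Multiset.map_map, Function.comp_def] using h3.symm

/-- The probability of Alice's mode being occupied. -/
noncomputable def occupation (φ : Ket qubit qubit) : ℝ := ‖φ (1, 0)‖ ^ 2 + ‖φ (1, 1)‖ ^ 2

theorem one_sub_occupation {φ : Ket qubit qubit} (hφ : IsPureState φ) :
    1 - occupation φ = ‖φ (0, 0)‖ ^ 2 + ‖φ (0, 1)‖ ^ 2 := by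
  have h := hφ.1
  rw [Fintype.sum_prod_type] at h
  simp only [Fin.sum_univ_two] at h
  rw [occupation]
  linarith

/-- A fixed total number lets Bob's basis state determine Alice's, so there are no coherences. -/
theorem reducedA_eq_diagonal {φ : Ket qubit qubit} (hφ : IsPureState φ) :
    φ.reducedA = Matrix.diagonal fun i => ((![1 - occupation φ, occupation φ] i : ℝ) : ℂ) := by
  have hoff : ∀ b : Fin 2, φ (0, b) = 0 ∨ φ (1, b) = 0 := fun b => by
    obtain ⟨n, hn⟩ := hφ.2
    by_contra! h
    have h0 := hn 0 b h.1
    have h1 := hn 1 b h.2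
    simp at h0 h1
    omega
  have hsq : ∀ z : ℂ, z * (starRingEnd ℂ) z = ((‖z‖ ^ 2 : ℝ) : ℂ) := fun z => by
    rw [Complex.mul_conj, Complex.normSq_eq_norm_sq]
  rw [one_sub_occupation hφ, occupation]
  ext i j
  fin_cases i <;> fin_cases j <;>
    simp [Ket.reducedA, Ket.proj, Matrix.vecMulVec_apply, hsq]
  · rcases hoff 0 with h | h <;> rcases hoff 1 with h' | h' <;> simp [h, h']
  · rcases hoff 0 with h | h <;> rcases hoff 1 with h' | h' <;> simp [h, h']

theorem entanglement_eq {φ : Ket qubit qubit} (hφ : IsPureState φ) :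
    φ.entanglement = Real.binEntropy (occupation φ) / Real.log 2 := by
  rw [Ket.entanglement, sum_eigenvalues_of_eq_diagonal _ _ (reducedA_eq_diagonal hφ),
    Real.binEntropy_eq_negMulLog_add_negMulLog_one_sub]
  simp [Fin.sum_univ_two, add_comm]

theorem siv_eq (φ : Ket qubit qubit) :
    φ.siv = 4 * (occupation φ * (1 - occupation φ)) := by
  have hsq : ∀ z : ℂ, (starRingEnd ℂ) z * z = ((‖z‖ ^ 2 : ℝ) : ℂ) := fun z => by
    rw [mul_comm, Complex.mul_conj, Complex.normSq_eq_norm_sq]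
  have h1 : φ.expect (numA qubit qubit) = occupation φ := by
    rw [Ket.expect, numA, ← Matrix.diagonal_one, Matrix.diagonal_kronecker_diagonal]
    simp [dotProduct, Matrix.mulVec_diagonal, Fintype.sum_prod_type, Fin.sum_univ_two, hsq,
      occupation, -Complex.ofReal_pow, Complex.ofReal_re]
  have h2 : numA qubit qubit * numA qubit qubit = numA qubit qubit := by
    rw [numA, ← Matrix.mul_kronecker_mul, Matrix.diagonal_mul_diagonal, Matrix.one_mul]
    congr 2
    funext i
    fin_cases i <;> simp
  rw [Ket.siv, h2, h1]
  ring

theorem IsPureState.qubit_cases {φ : Ket qubit qubit} (hφ : IsPureState φ) :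
    (0 < occupation φ ∧ occupation φ < 1 ∧ φ (0, 0) = 0 ∧ φ (1, 1) = 0 ∧
      ‖φ (1, 0)‖ ^ 2 = occupation φ ∧ ‖φ (0, 1)‖ ^ 2 = 1 - occupation φ) ∨
    ((occupation φ = 0 ∨ occupation φ = 1) ∧
      ∃ a₀ b₀, ‖φ (a₀, b₀)‖ = 1 ∧ ∀ a b, φ (a, b) ≠ 0 → a = a₀ ∧ b = b₀) := by
  have hp' := one_sub_occupation hφ
  have hp : occupation φ = ‖φ (1, 0)‖ ^ 2 + ‖φ (1, 1)‖ ^ 2 := rfl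
  have single : ∀ a₀ b₀ : Fin 2, (∀ a b, (a, b) ≠ (a₀, b₀) → φ (a, b) = 0) →
      ‖φ (a₀, b₀)‖ ^ 2 = 1 →
      ∃ a₀ b₀, ‖φ (a₀, b₀)‖ = 1 ∧ ∀ a b, φ (a, b) ≠ 0 → a = a₀ ∧ b = b₀ := by
    intro a₀ b₀ h h1
    refine ⟨a₀, b₀, (pow_eq_one_iff_of_nonneg (norm_nonneg _) two_ne_zero).1 h1,
      fun a b hab => ?_⟩
    by_contra hne
    exact hab (h a b fun he => hne (Prod.ext_iff.1 he))
  obtain ⟨n, hn⟩ := hφ.2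
  by_cases h1 : n = 1
  · have h00 : φ (0, 0) = 0 := by
      by_contra h
      have := hn 0 0 h
      simp at this
      omega
    have h11 : φ (1, 1) = 0 := by
      by_contra h
      have := hn 1 1 h
      simp at this
      omega
    simp only [h00, h11, norm_zero, ne_eq, OfNat.ofNat_ne_zero, not_false_eq_true, zero_pow,
      add_zero, zero_add] at hp hp'
    by_cases h10 : φ (1, 0) = 0
    · right
      simp only [h10, norm_zero, ne_eq, OfNat.ofNat_ne_zero, not_false_eq_true, zero_pow] at hp
      refine ⟨Or.inl hp, single 0 1 (by simp [Fin.forall_fin_two, *]) (by rw [← hp', hp, sub_zero])⟩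
    · by_cases h01 : φ (0, 1) = 0
      · right
        simp only [h01, norm_zero, ne_eq, OfNat.ofNat_ne_zero, not_false_eq_true, zero_pow] at hp'
        refine ⟨Or.inr (by linarith), single 1 0 (by simp [Fin.forall_fin_two, *]) (by rw [← hp]; linarith)⟩
      · left
        have hpos := pow_pos (norm_pos_iff.2 h10) 2
        have hpos' := pow_pos (norm_pos_iff.2 h01) 2
        exact ⟨by linarith, by linarith, h00, h11, hp.symm, hp'.symm⟩
  · right
    have h01 : φ (0, 1) = 0 := by
      by_contra h
      have := hn 0 1 h
      simp at this
      omega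
    have h10 : φ (1, 0) = 0 := by
      by_contra h
      have := hn 1 0 h
      simp at this
      omega
    simp only [h01, h10, norm_zero, ne_eq, OfNat.ofNat_ne_zero, not_false_eq_true, zero_pow,
      add_zero, zero_add] at hp hp'
    by_cases h00 : φ (0, 0) = 0
    · simp only [h00, norm_zero, ne_eq, OfNat.ofNat_ne_zero, not_false_eq_true, zero_pow] at hp'
      refine ⟨Or.inr (by linarith), single 1 1 (by simp [Fin.forall_fin_two, *]) (by rw [← hp]; linarith)⟩
    · have h11 : φ (1, 1) = 0 := by
        by_contra h
        have h0 := hn 0 0 h00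
        have h2 := hn 1 1 h
        simp at h0 h2
        omega
      simp only [h11, norm_zero, ne_eq, OfNat.ofNat_ne_zero, not_false_eq_true, zero_pow] at hp
      refine ⟨Or.inl hp, single 0 0 (by simp [Fin.forall_fin_two, *]) (by rw [← hp', hp, sub_zero])⟩

/-! ### Entropy exceeds variance -/

/-- The difference between the binary entropy and its quadratic lower bound. -/
noncomputable def entropyGap (p : ℝ) : ℝ := Real.binEntropy p - 4 * Real.log 2 * (p * (1 - p))

theorem hasDerivAt_entropyGap {p : ℝ} (h0 : 0 < p) (h1 : p < 1) :
    HasDerivAt entropyGap (Real.log (1 - p) - Real.log p - 4 * Real.log 2 * (1 - 2 * p)) p := by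
  have h := (Real.hasDerivAt_binEntropy h0.ne' h1.ne).sub
    (((hasDerivAt_id p).mul ((hasDerivAt_id p).const_sub 1)).const_mul (4 * Real.log 2))
  refine h.congr_deriv ?_
  simp only [id]
  ring

theorem hasDerivAt_deriv_entropyGap {p : ℝ} (h0 : 0 < p) (h1 : p < 1) :
    HasDerivAt (fun x => Real.log (1 - x) - Real.log x - 4 * Real.log 2 * (1 - 2 * x))
      (8 * Real.log 2 - 1 / (p * (1 - p))) p := by
  have h1' : 1 - p ≠ 0 := by linarith
  have h := ((((hasDerivAt_id p).const_sub 1).log h1').sub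
    (Real.hasDerivAt_log h0.ne')).sub
    ((((hasDerivAt_id p).const_mul 2).const_sub 1).const_mul (4 * Real.log 2))
  refine h.congr_deriv ?_
  have := h0.ne'
  simp only [id]
  field_simp
  ring

theorem continuous_entropyGap : Continuous entropyGap := by
  unfold entropyGap
  fun_prop

theorem entropyGap_half : entropyGap (1 / 2) = 0 := by
  rw [entropyGap, one_div, Real.binEntropy_two_inv]
  ring

/-- The hypothesis puts `p` in the region up to `1/2` where the gap is convex. Its derivative
vanishes at `1/2`, so the gap strictly decreases to its value `0` there. -/
theorem entropyGap_pos_of_le {p : ℝ} (h0 : 0 < p) (h1 : p < 1 / 2)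
    (h : 1 ≤ 8 * Real.log 2 * (p * (1 - p))) : 0 < entropyGap p := by
  have hmono : StrictMonoOn
      (fun x => Real.log (1 - x) - Real.log x - 4 * Real.log 2 * (1 - 2 * x)) (Set.Icc p (1 / 2)) := by
    refine strictMonoOn_of_deriv_pos (convex_Icc _ _) (fun x hx =>
      (hasDerivAt_deriv_entropyGap (by linarith [hx.1])
        (by linarith [hx.2])).continuousAt.continuousWithinAt) fun x hx => ?_
    rw [interior_Icc] at hx
    have hx0 : 0 < x := h0.trans hx.1
    have hx1 : 0 < 1 - x := by linarith [hx.2]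
    rw [(hasDerivAt_deriv_entropyGap hx0 (by linarith)).deriv, sub_pos,
      div_lt_iff₀ (mul_pos hx0 hx1)]
    have : p * (1 - p) < x * (1 - x) := by nlinarith [hx.1, hx.2]
    have := Real.log_pos one_lt_two
    nlinarith
  have hanti : StrictAntiOn entropyGap (Set.Icc p (1 / 2)) := by
    refine strictAntiOn_of_deriv_neg (convex_Icc _ _) continuous_entropyGap.continuousOn
      fun x hx => ?_
    rw [interior_Icc] at hx
    rw [(hasDerivAt_entropyGap (h0.trans hx.1) (by linarith [hx.2])).deriv]
    have := hmono (Set.Ioo_subset_Icc_self hx) (Set.right_mem_Icc.2 h1.le) hx.2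
    norm_num at this ⊢
    linarith
  have := hanti (Set.left_mem_Icc.2 h1.le) (Set.right_mem_Icc.2 h1.le) h1
  rwa [entropyGap_half] at this

/-- Below the inflection point `r` the gap is concave, zero at `0` and positive at `r`, so it lies
above a chord of positive slope. -/
theorem entropyGap_pos_of_lt_half {p : ℝ} (h0 : 0 < p) (h1 : p < 1 / 2) : 0 < entropyGap p := by
  by_cases h : 1 ≤ 8 * Real.log 2 * (p * (1 - p))
  · exact entropyGap_pos_of_le h0 h1 h
  · push Not at h
    have hlog := Real.log_two_gt_d9
    obtain ⟨r, hr, hr1⟩ : ∃ r ∈ Set.Ioo p (1 / 2), 8 * Real.log 2 * (r * (1 - r)) = 1 := by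
      have := intermediate_value_Ioo (a := p) (b := 1 / 2) h1.le
        (f := fun r => 8 * Real.log 2 * (r * (1 - r))) (by fun_prop)
      exact this ⟨h, by norm_num; linarith⟩
    have hr0 : 0 < r := h0.trans hr.1
    have hpos := entropyGap_pos_of_le hr0 hr.2 hr1.ge
    have hanti : AntitoneOn (deriv entropyGap) (interior (Set.Icc 0 r)) := by
      rw [interior_Icc]
      have hd : AntitoneOn
          (fun x => Real.log (1 - x) - Real.log x - 4 * Real.log 2 * (1 - 2 * x))
          (Set.Ioo 0 r) := by
        refine antitoneOn_of_deriv_nonpos (convex_Ioo _ _) (fun x hx =>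
          (hasDerivAt_deriv_entropyGap hx.1
            (by linarith [hx.2, hr.2])).continuousAt.continuousWithinAt) (fun x hx => ?_)
            fun x hx => ?_
        · rw [interior_Ioo] at hx
          exact (hasDerivAt_deriv_entropyGap hx.1
            (by linarith [hx.2, hr.2])).differentiableAt.differentiableWithinAt
        · rw [interior_Ioo] at hx
          have hx1 : 0 < 1 - x := by linarith [hx.2, hr.2]
          rw [(hasDerivAt_deriv_entropyGap hx.1 (by linarith)).deriv, sub_nonpos,
            le_div_iff₀ (mul_pos hx.1 hx1)]
          have : x * (1 - x) ≤ r * (1 - r) := by nlinarith [hx.1, hx.2, hr.2]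
          nlinarith
      refine hd.congr fun x hx => ?_
      exact (hasDerivAt_entropyGap hx.1 (by linarith [hx.2, hr.2])).deriv.symm
    have hconc : ConcaveOn ℝ (Set.Icc 0 r) entropyGap := by
      refine hanti.concaveOn_of_deriv (convex_Icc _ _) continuous_entropyGap.continuousOn
        fun x hx => ?_
      rw [interior_Icc] at hx
      exact (hasDerivAt_entropyGap hx.1
        (by linarith [hx.2, hr.2])).differentiableAt.differentiableWithinAt
    have hle := hconc.2 (Set.left_mem_Icc.2 hr0.le) (Set.right_mem_Icc.2 hr0.le)
      (sub_nonneg.2 ((div_le_one hr0).2 hr.1.le)) (div_nonneg h0.le hr0.le)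
      (sub_add_cancel 1 (p / r))
    have hzero : entropyGap 0 = 0 := by simp [entropyGap]
    simp only [smul_eq_mul, hzero, mul_zero, zero_add, div_mul_cancel₀ p hr0.ne'] at hle
    exact lt_of_lt_of_le (mul_pos (div_pos h0 hr0) hpos) hle

theorem entropyGap_pos {p : ℝ} (h0 : 0 < p) (h1 : p < 1) (h : p ≠ 1 / 2) : 0 < entropyGap p := by
  rcases lt_or_gt_of_ne h with h | h
  · exact entropyGap_pos_of_lt_half h0 h
  · have := entropyGap_pos_of_lt_half (p := 1 - p) (by linarith) (by linarith)
    rw [entropyGap, Real.binEntropy_one_sub] at this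
    rw [entropyGap]
    linarith

/-! ### Local comparison of binomial distributions -/

theorem binomialProb_nonneg {p : ℝ} (h0 : 0 ≤ p) (h1 : p ≤ 1) (N n : ℕ) :
    0 ≤ binomialProb N p n :=
  mul_nonneg (Nat.cast_nonneg _)
    (mul_nonneg (pow_nonneg h0 _) (pow_nonneg (sub_nonneg.2 h1) _))

theorem binomialProb_pos {p : ℝ} (h0 : 0 < p) (h1 : p < 1) {N n : ℕ} (h : n ≤ N) :
    0 < binomialProb N p n :=
  mul_pos (Nat.cast_pos.2 (Nat.choose_pos h)) (mul_pos (pow_pos h0 _) (pow_pos (sub_pos.2 h1) _))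

theorem sum_binomialProb (N : ℕ) (p : ℝ) : ∑ n ∈ Finset.range (N + 1), binomialProb N p n = 1 := by
  have h := add_pow p (1 - p) N
  rw [add_sub_cancel, one_pow] at h
  rw [h]
  exact Finset.sum_congr rfl fun n _ => by rw [binomialProb]; ring

theorem eval_bernsteinPolynomial (N : ℕ) (p : ℝ) (n : ℕ) :
    (bernsteinPolynomial ℝ N n).eval p = binomialProb N p n := by
  simp [bernsteinPolynomial, binomialProb, mul_assoc]

theorem sum_sq_mul_binomialProb (N : ℕ) (p : ℝ) :
    ∑ n ∈ Finset.range (N + 1), ((n : ℝ) - N * p) ^ 2 * binomialProb N p n = N * p * (1 - p) := by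
  have h := congrArg (Polynomial.eval p) (bernsteinPolynomial.variance ℝ N)
  simp only [Polynomial.eval_finsetSum, Polynomial.eval_mul, eval_bernsteinPolynomial] at h
  simp at h
  rw [← h]
  exact Finset.sum_congr rfl fun n _ => by ring

/-- Chebyshev's inequality, with the variance taken from the Bernstein polynomials. -/
theorem one_sub_le_sum_binomialProb {p : ℝ} (h0 : 0 ≤ p) (h1 : p ≤ 1) (N : ℕ) (W : Finset ℕ)
    {T : ℝ} (hT : 0 < T) (hW : ∀ n, n ∉ W → T ≤ |(n : ℝ) - N * p|) :
    1 - N * p * (1 - p) / T ^ 2 ≤ ∑ n ∈ W, binomialProb N p n := by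
  have hnn := binomialProb_nonneg h0 h1 N
  have htail : ∑ n ∈ (Finset.range (N + 1)).filter (· ∉ W), binomialProb N p n
      ≤ N * p * (1 - p) / T ^ 2 := by
    rw [le_div_iff₀ (by positivity), ← sum_sq_mul_binomialProb, Finset.sum_mul]
    refine le_trans (Finset.sum_le_sum fun n hn => ?_) (Finset.sum_le_sum_of_subset_of_nonneg
      (Finset.filter_subset _ _) fun n _ _ => mul_nonneg (sq_nonneg _) (hnn n))
    rw [mul_comm]
    refine mul_le_mul_of_nonneg_right ?_ (hnn n)
    rw [← sq_abs ((n : ℝ) - N * p)]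
    exact pow_le_pow_left₀ hT.le (hW n (Finset.mem_filter.1 hn).2) 2
  have hin : ∑ n ∈ (Finset.range (N + 1)).filter (· ∈ W), binomialProb N p n
      ≤ ∑ n ∈ W, binomialProb N p n :=
    Finset.sum_le_sum_of_subset_of_nonneg (fun n hn => (Finset.mem_filter.1 hn).2)
      fun n _ _ => hnn n
  have hsplit := Finset.sum_filter_add_sum_filter_not (Finset.range (N + 1)) (· ∈ W)
    (binomialProb N p)
  rw [sum_binomialProb] at hsplit
  linarith

/-- Chebyshev's inequality for a window of radius `τ` around the mean. -/
theorem one_sub_le_sum_window {p : ℝ} (h0 : 0 ≤ p) (h1 : p ≤ 1) (N c τ : ℕ) (hτ : 0 < τ)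
    (hτc : τ ≤ c) (hc : (c : ℝ) ≤ N * p) (hc' : N * p < c + 1) :
    1 - N * p * (1 - p) / (τ : ℝ) ^ 2
      ≤ ∑ k ∈ Finset.range (2 * τ + 1), binomialProb N p (c - τ + k) := by
  have h := one_sub_le_sum_binomialProb h0 h1 N ((Finset.range (2 * τ + 1)).map
    (addLeftEmbedding (c - τ))) (T := τ) (Nat.cast_pos.2 hτ) fun n hn => by
      have hn' : n + τ + 1 ≤ c ∨ c + τ + 1 ≤ n := by
        by_contra! hcon
        refine hn (Finset.mem_map.2 ⟨n - (c - τ), Finset.mem_range.2 (by omega), ?_⟩)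
        simp only [addLeftEmbedding_apply]
        omega
      rcases hn' with hn' | hn'
      · have : (n : ℝ) + τ + 1 ≤ c := by exact_mod_cast hn'
        rw [abs_sub_comm]
        exact le_trans (by linarith) (le_abs_self _)
      · have : (c : ℝ) + τ + 1 ≤ n := by exact_mod_cast hn'
        exact le_trans (by linarith) (le_abs_self _)
  rwa [Finset.sum_map] at h

theorem binomialProb_succ {p : ℝ} {N n : ℕ} (h : n < N) :
    binomialProb N p (n + 1) * ((n + 1) * (1 - p)) = binomialProb N p n * ((N - n) * p) := by
  have hch : (N.choose (n + 1) : ℝ) * (n + 1) = N.choose n * (N - n) := by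
    have := congrArg (Nat.cast : ℕ → ℝ) (Nat.choose_succ_right_eq N n)
    push_cast [Nat.cast_sub h.le] at this
    exact this
  obtain ⟨j, rfl⟩ := Nat.exists_eq_add_of_lt h
  have e1 : n + j + 1 - (n + 1) = j := by omega
  have e2 : n + j + 1 - n = j + 1 := by omega
  rw [binomialProb, binomialProb, e1, e2, pow_succ, pow_succ]
  linear_combination (p ^ n * p * (1 - p) ^ j * (1 - p)) * hch

/-- Telescoping: `P / Q` changes by a factor of at most `r` per step in either direction, and `k`,
`l` are at most `M` apart. -/
theorem mul_le_pow_mul_of_ratio {P Q : ℕ → ℝ} {r : ℝ} {M : ℕ} (hr : 1 ≤ r)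
    (hP : ∀ k ≤ M, 0 < P k) (hQ : ∀ k ≤ M, 0 < Q k)
    (h : ∀ k < M, P (k + 1) * Q k ≤ r * (P k * Q (k + 1)))
    (h' : ∀ k < M, P k * Q (k + 1) ≤ r * (P (k + 1) * Q k)) {k l : ℕ} (hk : k ≤ M) (hl : l ≤ M) :
    P k * Q l ≤ r ^ M * (P l * Q k) := by
  have hr0 : 0 ≤ r := zero_le_one.trans hr
  have hmain : ∀ j k, k + j ≤ M → P (k + j) / Q (k + j) ≤ r ^ j * (P k / Q k) ∧
      P k / Q k ≤ r ^ j * (P (k + j) / Q (k + j)) := by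
    intro j
    induction j with
    | zero => intro k _; simp
    | succ j ih =>
      intro k hkj
      obtain ⟨h1, h2⟩ := ih k (by omega)
      have hq1 := hQ (k + j) (by omega)
      have hq2 := hQ (k + j + 1) (by omega)
      have s1 : P (k + j + 1) / Q (k + j + 1) ≤ r * (P (k + j) / Q (k + j)) := by
        rw [← mul_div_assoc, div_le_div_iff₀ hq2 hq1]
        linarith [h (k + j) (by omega)]
      have s2 : P (k + j) / Q (k + j) ≤ r * (P (k + j + 1) / Q (k + j + 1)) := by
        rw [← mul_div_assoc, div_le_div_iff₀ hq1 hq2]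
        linarith [h' (k + j) (by omega)]
      rw [← add_assoc]
      constructor
      · calc _ ≤ r * (P (k + j) / Q (k + j)) := s1
          _ ≤ r * (r ^ j * (P k / Q k)) := mul_le_mul_of_nonneg_left h1 hr0
          _ = _ := by ring
      · calc _ ≤ r ^ j * (P (k + j) / Q (k + j)) := h2
          _ ≤ r ^ j * (r * (P (k + j + 1) / Q (k + j + 1))) :=
            mul_le_mul_of_nonneg_left s2 (pow_nonneg hr0 _)
          _ = _ := by ring
  have hle : ∀ j ≤ M, r ^ j ≤ r ^ M := fun j hj => pow_le_pow_right₀ hr hj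
  have hdiv : P k / Q k ≤ r ^ M * (P l / Q l) := by
    have hpos : 0 ≤ P l / Q l := (div_pos (hP l hl) (hQ l hl)).le
    rcases le_total k l with hkl | hkl
    · obtain ⟨j, rfl⟩ := Nat.exists_eq_add_of_le hkl
      exact (hmain j k hl).2.trans (mul_le_mul_of_nonneg_right (hle j (by omega)) hpos)
    · obtain ⟨j, rfl⟩ := Nat.exists_eq_add_of_le hkl
      exact (hmain j l hk).1.trans (mul_le_mul_of_nonneg_right (hle j (by omega)) hpos)
  rw [← mul_div_assoc, div_le_div_iff₀ (hQ k hk) (hQ l hl)] at hdiv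
  linarith

/-- Two distributions on a window that have almost full weight there and almost constant ratio are
close to each other. -/
theorem mul_le_of_cross_le {P Q : ℕ → ℝ} {η : ℝ} {W : Finset ℕ} (hη : η ≤ 1)
    (hP : ∀ k ∈ W, 0 ≤ P k) (hQ : ∀ k ∈ W, 0 ≤ Q k)
    (hQ1 : 1 - η ≤ ∑ k ∈ W, Q k) (hP1 : ∑ k ∈ W, P k ≤ 1)
    (h : ∀ k ∈ W, ∀ l ∈ W, (1 - η) * (P k * Q l) ≤ P l * Q k) {k : ℕ} (hk : k ∈ W) :
    (1 - η) ^ 2 * P k ≤ Q k := by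
  have hsum := Finset.sum_le_sum (h k hk)
  rw [← Finset.mul_sum, ← Finset.mul_sum, ← Finset.sum_mul] at hsum
  calc (1 - η) ^ 2 * P k = (1 - η) * (P k * (1 - η)) := by ring
    _ ≤ (1 - η) * (P k * ∑ l ∈ W, Q l) := mul_le_mul_of_nonneg_left
        (mul_le_mul_of_nonneg_left hQ1 (hP k hk)) (sub_nonneg.2 hη)
    _ ≤ (∑ l ∈ W, P l) * Q k := hsum
    _ ≤ Q k := mul_le_of_le_one_left (hQ k hk) hP1

theorem sum_window_le_one {p : ℝ} (h0 : 0 ≤ p) (h1 : p ≤ 1) (N n M : ℕ) (h : n + M ≤ N + 1) :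
    ∑ k ∈ Finset.range M, binomialProb N p (n + k) ≤ 1 := by
  rw [← sum_binomialProb N p]
  have := Finset.sum_map (Finset.range M) (addLeftEmbedding n) (binomialProb N p)
  simp only [addLeftEmbedding_apply] at this
  rw [← this]
  refine Finset.sum_le_sum_of_subset_of_nonneg (fun i hi => ?_)
    fun i _ _ => binomialProb_nonneg h0 h1 N i
  obtain ⟨k, hk, rfl⟩ := Finset.mem_map.1 hi
  have := Finset.mem_range.1 hk
  simp only [addLeftEmbedding_apply, Finset.mem_range]
  omega

/-- The key estimate behind the local comparison of binomial distributions of equal variance. -/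
theorem abs_cross_sub_le {p q N v t s f τ : ℝ} (hp : 0 ≤ p) (hq : 0 ≤ q) (hpq : p + q = 1)
    (hv : v = 4 * p * q * N - f) (hv0 : 0 ≤ v) (hvN : v ≤ N) (hf0 : 0 ≤ f) (hf1 : f ≤ 1)
    (hτ : 1 ≤ τ) (ht : |t| ≤ τ) (hs : |s| ≤ τ) (hst : |s - t| ≤ 1) :
    |(N - (N * p + t)) * p * (v / 2 + s + 1) - (N * p + t + 1) * q * (v - (v / 2 + s))|
      ≤ 2 * N + 4 * τ ^ 2 := by
  -- The terms of order `N²` cancel at the means. As `v ≈ 4pqN`, the terms linear in the deviations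
  -- combine to `v / 2 * (s - t)`, which is only of order `N`.
  have hid : (N - (N * p + t)) * p * (v / 2 + s + 1) - (N * p + t + 1) * q * (v - (v / 2 + s))
      = v / 2 * (s - t) + v / 4 - q * (v / 2) + f * (2 * s + 1) / 4
        + ((q - p) * (t * s) - p * t + q * s) := by
    obtain rfl : q = 1 - p := by linarith
    rw [hv]
    ring
  rw [hid]
  have hq1 : q ≤ 1 := by linarith
  have hp1 : p ≤ 1 := by linarith
  have hts : |t * s| ≤ τ ^ 2 := by
    rw [abs_mul, sq]
    exact mul_le_mul ht hs (abs_nonneg _) (by linarith)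
  have e1 : |v / 2 * (s - t)| ≤ v / 2 := by
    rw [abs_mul, abs_of_nonneg (by linarith : 0 ≤ v / 2)]
    exact mul_le_of_le_one_right (by linarith) hst
  have e2 : |(q - p) * (t * s)| ≤ τ ^ 2 := by
    rw [abs_mul]
    refine le_trans (mul_le_of_le_one_left (abs_nonneg _) ?_) hts
    rw [abs_le]
    constructor <;> linarith
  have e3 : |p * t| ≤ τ := by
    rw [abs_mul, abs_of_nonneg hp]
    exact (mul_le_of_le_one_left (abs_nonneg _) hp1).trans ht
  have e4 : |q * s| ≤ τ := by
    rw [abs_mul, abs_of_nonneg hq]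
    exact (mul_le_of_le_one_left (abs_nonneg _) hq1).trans hs
  have e5 : |f * (2 * s + 1)| ≤ 2 * τ + 1 := by
    rw [abs_mul, abs_of_nonneg hf0]
    refine (mul_le_of_le_one_left (abs_nonneg _) hf1).trans ?_
    rw [abs_le] at hs ⊢
    constructor <;> linarith [hs.1, hs.2]
  have e6 : 0 ≤ q * (v / 2) := mul_nonneg hq (by linarith)
  have e7 : q * (v / 2) ≤ v / 2 := mul_le_of_le_one_left (by linarith) hq1
  have hτ2 : τ ≤ τ ^ 2 := by nlinarith
  rw [abs_le] at *
  constructor <;> linarith [e1.1, e1.2, e2.1, e2.2, e3.1, e3.2, e4.1, e4.2, e5.1, e5.2]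

/-- For successive ratios `P'/P = A/B` and `Q'/Q = A'/B'`, comparing `P'Q` with `PQ'` amounts to
comparing `AB'` with `BA'`. -/
theorem cross_mul_le {P P' Q Q' A B A' B' r : ℝ} (hP : 0 ≤ P) (hQ : 0 ≤ Q) (hB : 0 < B)
    (hB' : 0 < B') (h₁ : P' * B = P * A) (h₂ : Q' * B' = Q * A') :
    (A * B' ≤ r * (B * A') → P' * Q ≤ r * (P * Q')) ∧
    (B * A' ≤ r * (A * B') → P * Q' ≤ r * (P' * Q)) := by
  have e1 : P' * Q * (B * B') = P * Q * (A * B') := by linear_combination Q * B' * h₁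
  have e2 : P * Q' * (B * B') = P * Q * (B * A') := by linear_combination P * B * h₂
  constructor
  · intro h
    refine le_of_mul_le_mul_right ?_ (mul_pos hB hB')
    calc P' * Q * (B * B') = P * Q * (A * B') := e1
      _ ≤ P * Q * (r * (B * A')) := mul_le_mul_of_nonneg_left h (mul_nonneg hP hQ)
      _ = r * (P * Q') * (B * B') := by linear_combination -r * e2
  · intro h
    refine le_of_mul_le_mul_right ?_ (mul_pos hB hB')
    calc P * Q' * (B * B') = P * Q * (B * A') := e2
      _ ≤ P * Q * (r * (A * B')) := mul_le_mul_of_nonneg_left h (mul_nonneg hP hQ)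
      _ = r * (P' * Q) * (B * B') := by linear_combination -r * e1

/-- In a window of radius `τ` around the means, the ratio of the two binomial probabilities changes
by a factor close to one at each step. -/
theorem binomialProb_cross_succ {p : ℝ} (h0 : 0 < p) (h1 : p < 1) {N v τ c c' k : ℕ}
    (hv : v = ⌊(N : ℝ) * (4 * (p * (1 - p)))⌋₊) (hc : c = ⌊(N : ℝ) * p⌋₊) (hc' : c' = v / 2)
    (hτ : (τ : ℝ) + 2 ≤ p * (1 - p) * N / 2) (hk : k < 2 * τ) :
    (τ ≤ c ∧ τ ≤ c' ∧ c + τ ≤ N ∧ c' + τ ≤ v) ∧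
    binomialProb N p (c - τ + (k + 1)) * binomialProb v (1 / 2) (c' - τ + k)
      ≤ (1 + (2 * N + 4 * (τ + 1 : ℝ) ^ 2) / ((p * (1 - p) * N) ^ 2 / 2)) *
        (binomialProb N p (c - τ + k) * binomialProb v (1 / 2) (c' - τ + (k + 1))) ∧
    binomialProb N p (c - τ + k) * binomialProb v (1 / 2) (c' - τ + (k + 1))
      ≤ (1 + (2 * N + 4 * (τ + 1 : ℝ) ^ 2) / ((p * (1 - p) * N) ^ 2 / 2)) *
        (binomialProb N p (c - τ + (k + 1)) * binomialProb v (1 / 2) (c' - τ + k)) := by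
  set q := 1 - p with hq
  have hq0 : 0 < q := by linarith
  have hN0 : (0 : ℝ) ≤ N := Nat.cast_nonneg _
  have hτ0 : (0 : ℝ) ≤ τ := Nat.cast_nonneg _
  have hpqN : p * q * N ≤ p * N := by nlinarith [mul_nonneg h0.le hN0]
  have hpqN' : p * q * N ≤ q * N := by nlinarith [mul_nonneg hq0.le hN0]
  have hvle : (v : ℝ) ≤ N * (4 * (p * q)) := hv ▸ Nat.floor_le (by positivity)
  have hvlt : N * (4 * (p * q)) < v + 1 := hv ▸ Nat.lt_floor_add_one _
  have hcle : (c : ℝ) ≤ N * p := hc ▸ Nat.floor_le (by positivity)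
  have hclt : N * p < c + 1 := hc ▸ Nat.lt_floor_add_one _
  have hc2 : (2 * c' : ℝ) ≤ v := by
    have : 2 * c' ≤ v := by omega
    exact_mod_cast this
  have hc2' : (v : ℝ) ≤ 2 * c' + 1 := by
    have : v ≤ 2 * c' + 1 := by omega
    exact_mod_cast this
  have hsum : N * p + N * q = N := by rw [hq]; ring
  have b1 : τ ≤ c := by
    have : (τ : ℝ) ≤ c := by linarith
    exact_mod_cast this
  have b2 : τ ≤ c' := by
    have : (τ : ℝ) ≤ c' := by linarith
    exact_mod_cast this
  have b3 : c + τ ≤ N := by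
    have : (c : ℝ) + τ ≤ N := by linarith
    exact_mod_cast this
  have b4 : c' + τ ≤ v := by
    have : (c' : ℝ) + τ ≤ v := by linarith
    exact_mod_cast this
  refine ⟨⟨b1, b2, b3, b4⟩, ?_⟩
  set n := c - τ + k with hn
  set m := c' - τ + k with hm
  have hnN : n < N := by omega
  have hmv : m < v := by omega
  have hnr : (n : ℝ) = c - τ + k := by rw [hn]; push_cast [Nat.cast_sub b1]; ring
  have hmr : (m : ℝ) = c' - τ + k := by rw [hm]; push_cast [Nat.cast_sub b2]; ring
  have hk0 : (0 : ℝ) ≤ k := Nat.cast_nonneg _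
  have hk2 : (k : ℝ) + 1 ≤ 2 * τ := by exact_mod_cast hk
  have hP := binomialProb_succ (p := p) hnN
  have hQ : binomialProb v (1 / 2) (m + 1) * (m + 1) = binomialProb v (1 / 2) m * (v - m) := by
    have := binomialProb_succ (p := 1 / 2) hmv
    linear_combination 2 * this
  have hmvr : (m : ℝ) < v := by exact_mod_cast hmv
  obtain ⟨g1, g2⟩ := cross_mul_le
    (r := 1 + (2 * N + 4 * (τ + 1 : ℝ) ^ 2) / ((p * q * N) ^ 2 / 2))
    (binomialProb_nonneg h0.le h1.le N n)
    (binomialProb_nonneg (by norm_num) (by norm_num) v m)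
    (mul_pos (by positivity) hq0) (by positivity : (0 : ℝ) < m + 1) hP hQ
  -- `t` and `s` are the deviations from the two means. They differ only by the rounding of the
  -- centres, hence by at most `1`; `τ + 1` allows for that rounding, and `f` is the part lost in
  -- the floor defining `v`.
  have habs := abs_cross_sub_le (p := p) (q := q) (N := N) (v := v) (t := n - N * p)
    (s := m - v / 2) (f := N * (4 * (p * q)) - v) (τ := τ + 1) h0.le hq0.le (by rw [hq]; ring)
    (by ring) (Nat.cast_nonneg _) (by nlinarith [sq_nonneg (p - q)]) (by linarith) (by linarith)
    (by linarith) (by rw [abs_le]; constructor <;> linarith)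
    (by rw [abs_le]; constructor <;> linarith) (by rw [abs_le]; constructor <;> linarith)
  have ea : (N - (N * p + ((n : ℝ) - N * p))) * p * (v / 2 + (m - v / 2) + 1)
      = (N - n) * p * (m + 1) := by ring
  have eb : (N * p + ((n : ℝ) - N * p) + 1) * q * (v - (v / 2 + (m - v / 2)))
      = (n + 1) * q * (v - m) := by ring
  rw [ea, eb, abs_le] at habs
  set E := 2 * (N : ℝ) + 4 * (τ + 1 : ℝ) ^ 2 with hE
  -- The window stays away from the ends of both ranges, so `D` bounds both cross products from
  -- below and `E / D` is the relative error per step.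
  set D := (p * q * N) ^ 2 / 2 with hD
  have hpos : 0 < p * q * N := by linarith
  have hD0 : 0 < D := by positivity
  have hE0 : 0 ≤ E := by positivity
  have low1 : D ≤ (N - n) * p * (m + 1) := by
    have f1 : q * N / 2 ≤ N - n := by linarith
    have f2 : p * q * N ≤ m + 1 := by linarith
    calc D = (q * N / 2) * p * (p * q * N) := by rw [hD]; ring
      _ ≤ (N - n) * p * (m + 1) := mul_le_mul (mul_le_mul_of_nonneg_right f1 h0.le) f2 hpos.le
        (mul_nonneg (le_trans (by positivity) f1) h0.le)
  have low2 : D ≤ (n + 1) * q * (v - m) := by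
    have f1 : p * N / 2 ≤ n + 1 := by linarith
    have f2 : p * q * N ≤ v - m := by linarith
    calc D = (p * N / 2) * q * (p * q * N) := by rw [hD]; ring
      _ ≤ (n + 1) * q * (v - m) := by gcongr
  have scale : ∀ y, D ≤ y → E ≤ E / D * y := fun y hy => by
    rw [div_mul_eq_mul_div, le_div_iff₀ hD0]
    exact mul_le_mul_of_nonneg_left hy hE0
  refine ⟨g1 ?_, g2 ?_⟩
  · have := scale _ low2
    linarith [habs.2]
  · have := scale _ low1
    linarith [habs.1]

/-- Local comparison of the binomial distribution with parameters `N`, `p` and the symmetric one with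
(almost) the same variance: up to a shift they agree up to a factor close to one in a window of
width of order `√N`, which carries almost all of the weight. -/
theorem exists_window {p : ℝ} (h0 : 0 < p) (h1 : p < 1) {η : ℝ} (hη0 : 0 < η) (hη1 : η ≤ 1) :
    ∃ K : ℝ, ∀ᶠ N : ℕ in Filter.atTop, ∃ n₁ m₁ M : ℕ,
      (∀ k ∈ Finset.range M, |((n₁ + k : ℕ) : ℝ) - N * p| ≤ K * √N ∧ n₁ + k ≤ N ∧
        m₁ + k ≤ ⌊(N : ℝ) * (4 * (p * (1 - p)))⌋₊ ∧
        (1 - η) ^ 2 * binomialProb N p (n₁ + k)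
          ≤ binomialProb ⌊(N : ℝ) * (4 * (p * (1 - p)))⌋₊ (1 / 2) (m₁ + k) ∧
        (1 - η) ^ 2 * binomialProb ⌊(N : ℝ) * (4 * (p * (1 - p)))⌋₊ (1 / 2) (m₁ + k)
          ≤ binomialProb N p (n₁ + k)) ∧
      1 - η ≤ ∑ k ∈ Finset.range M, binomialProb N p (n₁ + k) := by
  obtain ⟨L, hL⟩ := exists_nat_gt (1 / η)
  have hq0 : 0 < 1 - p := by linarith
  have hpq : 0 < p * (1 - p) := mul_pos h0 hq0
  have hL1 : 1 < (L : ℝ) := lt_of_le_of_lt ((one_le_div hη0).2 hη1) hL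
  set x : ℝ := p * (1 - p) with hx
  have hx4 : x ≤ 1 / 4 := by rw [hx]; nlinarith [sq_nonneg (p - 1 / 2)]
  have hsqrt : Filter.Tendsto (fun N : ℕ => √(N : ℝ)) Filter.atTop Filter.atTop :=
    Real.tendsto_sqrt_atTop.comp tendsto_natCast_atTop_atTop
  refine ⟨2 * L + 2, ?_⟩
  -- The first bound on `√N` keeps the window away from the ends of both ranges. The second makes
  -- the errors of order `1/N`, accumulated over the `2τ` steps, at most `η`; its constant is `4 *
  -- 76`, from `τ ≤ 2L√N` and `hyle`.
  filter_upwards [Filter.eventually_ge_atTop 1,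
    hsqrt.eventually_ge_atTop ((4 * L + 4) / x),
    hsqrt.eventually_ge_atTop (304 * L ^ 3 / (x ^ 2 * η))] with N hN1 hS1 hS2
  set v := ⌊(N : ℝ) * (4 * x)⌋₊ with hv
  set c := ⌊(N : ℝ) * p⌋₊ with hc
  set S := √(N : ℝ) with hS
  have hN1' : (1 : ℝ) ≤ N := by exact_mod_cast hN1
  have hSS : S ^ 2 = N := Real.sq_sqrt (Nat.cast_nonneg _)
  have hSone : 1 ≤ S := Real.one_le_sqrt.2 hN1'
  -- An integer radius between `L√N` and `2L√N`; `L > 1/η` makes the Chebyshev tail at most `η`.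
  set τ := L * (Nat.sqrt N + 1) with hτ
  have hτlow : L * S ≤ τ := by
    rw [hτ]
    push_cast
    exact mul_le_mul_of_nonneg_left Real.real_sqrt_lt_nat_sqrt_succ.le (Nat.cast_nonneg _)
  have hτup : (τ : ℝ) ≤ 2 * L * S := by
    have : (Nat.sqrt N : ℝ) ≤ S := Real.nat_sqrt_le_real_sqrt
    rw [hτ]
    push_cast
    nlinarith
  have hτpos : (0 : ℝ) < τ := lt_of_lt_of_le (by positivity) hτlow
  have hwin : (τ : ℝ) + 2 ≤ x * N / 2 := by
    rw [div_le_iff₀ hpq] at hS1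
    rw [← hSS]
    nlinarith
  have hcross := fun k hk => binomialProb_cross_succ h0 h1 (c' := v / 2) (k := k) hv hc rfl hwin hk
  obtain ⟨b1, b2, b3, b4⟩ := (hcross 0 (by
    have : 0 < τ := by exact_mod_cast hτpos
    omega)).1
  set r := 1 + (2 * N + 4 * (τ + 1 : ℝ) ^ 2) / ((x * N) ^ 2 / 2) with hr
  set P : ℕ → ℝ := fun k => binomialProb N p (c - τ + k) with hP
  set Q : ℕ → ℝ := fun k => binomialProb v (1 / 2) (v / 2 - τ + k) with hQ
  have hP0 : ∀ k ≤ 2 * τ, 0 < P k := fun k hk => binomialProb_pos h0 h1 (by omega)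
  have hQ0 : ∀ k ≤ 2 * τ, 0 < Q k := fun k hk =>
    binomialProb_pos (by norm_num) (by norm_num) (by omega)
  have hr1 : 1 ≤ r := by
    rw [hr]
    exact le_add_of_nonneg_right (by positivity)
  have hratio : ∀ k ≤ 2 * τ, ∀ l ≤ 2 * τ, P k * Q l ≤ r ^ (2 * τ) * (P l * Q k) :=
    fun k hk l hl => mul_le_pow_mul_of_ratio hr1 hP0 hQ0 (fun k hk => (hcross k hk).2.1)
      (fun k hk => (hcross k hk).2.2) hk hl
  have hrη : (1 - η) * r ^ (2 * τ) ≤ 1 := by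
    set y := (2 * N + 4 * (τ + 1 : ℝ) ^ 2) / ((x * N) ^ 2 / 2) with hy
    have hy0 : 0 ≤ y := by positivity
    have hyle : y ≤ 76 * L ^ 2 / (x ^ 2 * N) := by
      rw [hy, div_le_div_iff₀ (by positivity) (by positivity)]
      have hτ1 : (τ : ℝ) + 1 ≤ 3 * L * S := by nlinarith
      have hsq : (τ + 1 : ℝ) ^ 2 ≤ 9 * L ^ 2 * N := by
        calc (τ + 1 : ℝ) ^ 2 ≤ (3 * L * S) ^ 2 := pow_le_pow_left₀ (by positivity) hτ1 2
          _ = 9 * L ^ 2 * N := by rw [← hSS]; ring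
      have : 2 * (N : ℝ) ≤ 2 * L ^ 2 * N :=
        mul_le_mul_of_nonneg_right (by linarith [one_le_pow₀ hL1.le (n := 2)]) (Nat.cast_nonneg _)
      calc (2 * N + 4 * (τ + 1 : ℝ) ^ 2) * (x ^ 2 * N) ≤ (38 * L ^ 2 * N) * (x ^ 2 * N) :=
            mul_le_mul_of_nonneg_right (by linarith) (by positivity)
        _ = 76 * L ^ 2 * ((x * N) ^ 2 / 2) := by ring
    have hty : 2 * τ * y ≤ η := by
      rw [div_le_iff₀ (by positivity)] at hS2
      calc 2 * τ * y ≤ 2 * (2 * L * S) * (76 * L ^ 2 / (x ^ 2 * N)) := by gcongr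
        _ = 304 * L ^ 3 / (x ^ 2 * S) := by rw [← hSS]; field_simp; norm_num
        _ ≤ η := by rw [div_le_iff₀ (by positivity)]; linarith
    have hexp : r ^ (2 * τ) ≤ Real.exp (2 * τ * y) := by
      calc r ^ (2 * τ) ≤ Real.exp y ^ (2 * τ) :=
            pow_le_pow_left₀ (by linarith) (by rw [hr, add_comm]; exact Real.add_one_le_exp y) _
        _ = Real.exp (2 * τ * y) := by rw [← Real.exp_nat_mul]; push_cast; rfl
    calc (1 - η) * r ^ (2 * τ) ≤ Real.exp (-(2 * τ * y)) * Real.exp (2 * τ * y) := by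
          refine mul_le_mul ?_ hexp (by positivity) (Real.exp_nonneg _)
          linarith [Real.add_one_le_exp (-(2 * τ * y))]
      _ = 1 := by rw [← Real.exp_add]; simp
  have hcrossη : ∀ k ≤ 2 * τ, ∀ l ≤ 2 * τ, (1 - η) * (P k * Q l) ≤ P l * Q k := by
    intro k hk l hl
    calc (1 - η) * (P k * Q l) ≤ (1 - η) * (r ^ (2 * τ) * (P l * Q k)) :=
          mul_le_mul_of_nonneg_left (hratio k hk l hl) (sub_nonneg.2 hη1)
      _ = (1 - η) * r ^ (2 * τ) * (P l * Q k) := by ring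
      _ ≤ P l * Q k := mul_le_of_le_one_left (mul_pos (hP0 l hl) (hQ0 k hk)).le hrη
  have htail : N * x / (τ : ℝ) ^ 2 ≤ η := by
    rw [div_le_iff₀ (by positivity)]
    rw [div_lt_iff₀ hη0] at hL
    have : (L * S) ^ 2 ≤ (τ : ℝ) ^ 2 := pow_le_pow_left₀ (by positivity) hτlow 2
    rw [mul_pow, hSS] at this
    have hηL : 1 ≤ η * (L : ℝ) ^ 2 := by nlinarith
    calc N * x ≤ N * 1 := mul_le_mul_of_nonneg_left (by linarith) (Nat.cast_nonneg _)
      _ ≤ N * (η * (L : ℝ) ^ 2) := mul_le_mul_of_nonneg_left hηL (Nat.cast_nonneg _)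
      _ = η * ((L : ℝ) ^ 2 * N) := by ring
      _ ≤ η * (τ : ℝ) ^ 2 := mul_le_mul_of_nonneg_left this hη0.le
  have hvle : (v : ℝ) ≤ N * (4 * x) := Nat.floor_le (by positivity)
  have hτN : 0 < τ := by exact_mod_cast hτpos
  have hPsum : 1 - η ≤ ∑ k ∈ Finset.range (2 * τ + 1), P k := by
    refine le_trans ?_ (one_sub_le_sum_window h0.le h1.le N c τ hτN b1
      (Nat.floor_le (by positivity)) (Nat.lt_floor_add_one _))
    rw [mul_assoc, ← hx]
    linarith
  have hQsum : 1 - η ≤ ∑ k ∈ Finset.range (2 * τ + 1), Q k := by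
    have e1 : 2 * (v / 2) ≤ v := by omega
    have e2 : v < 2 * (v / 2) + 2 := by omega
    have e1' : 2 * ((v / 2 : ℕ) : ℝ) ≤ v := by exact_mod_cast e1
    have e2' : (v : ℝ) < 2 * ((v / 2 : ℕ) : ℝ) + 2 := by exact_mod_cast e2
    refine le_trans ?_ (one_sub_le_sum_window (by norm_num) (by norm_num) v (v / 2) τ hτN b2
      (by linarith) (by linarith))
    have : (v : ℝ) * (1 / 2) * (1 - 1 / 2) / (τ : ℝ) ^ 2 ≤ N * x / (τ : ℝ) ^ 2 :=
      div_le_div_of_nonneg_right (by linarith) (sq_nonneg _)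
    linarith
  have hPle : ∑ k ∈ Finset.range (2 * τ + 1), P k ≤ 1 :=
    sum_window_le_one h0.le h1.le N _ _ (by omega)
  have hQle : ∑ k ∈ Finset.range (2 * τ + 1), Q k ≤ 1 :=
    sum_window_le_one (by norm_num) (by norm_num) v _ _ (by omega)
  have hmem : ∀ k ∈ Finset.range (2 * τ + 1), k ≤ 2 * τ := fun k hk => by
    have := Finset.mem_range.1 hk
    omega
  refine ⟨c - τ, v / 2 - τ, 2 * τ + 1, fun k hk => ⟨?_, ?_, ?_, ?_, ?_⟩, hPsum⟩
  · have hcle : (c : ℝ) ≤ N * p := Nat.floor_le (by positivity)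
    have hclt : N * p < c + 1 := Nat.lt_floor_add_one _
    have hk' : (k : ℝ) ≤ 2 * τ := by exact_mod_cast hmem k hk
    push_cast [Nat.cast_sub b1]
    have hk0 : (0 : ℝ) ≤ k := Nat.cast_nonneg k
    have hK : (2 * L + 2) * S = 2 * L * S + 2 * S := by ring
    rw [abs_le, hK]
    constructor <;> linarith
  · have := hmem k hk
    omega
  · have := hmem k hk
    omega
  · exact mul_le_of_cross_le hη1 (fun k hk => (hP0 k (hmem k hk)).le)
      (fun k hk => (hQ0 k (hmem k hk)).le) hQsum hPle
      (fun k hk l hl => hcrossη k (hmem k hk) l (hmem l hl)) hk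
  · exact mul_le_of_cross_le hη1 (fun k hk => (hQ0 k (hmem k hk)).le)
      (fun k hk => (hP0 k (hmem k hk)).le) hPsum hQle
      (fun k hk l hl => by
        have := hcrossη l (hmem l hl) k (hmem k hk)
        linarith [mul_comm (P l) (Q k), mul_comm (P k) (Q l)]) hk

/-! ### Block dimensions, fidelity and the asymptotic conversions -/

theorem blockCard_pow_mul (N n : ℕ) (p : ℝ) :
    (blockCard (Finset.card : Finset (Fin N) → ℕ) n : ℝ) * (p ^ n * (1 - p) ^ (N - n))
      = binomialProb N p n := by
  rw [blockCard_card, binomialProb]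

theorem blockCard_epr_mul (e v m : ℕ) :
    (blockCard (fun y : (Fin e → Fin 2) × Finset (Fin v) => y.2.card) m : ℝ) *
      ((1 / 2) ^ e * ((1 / 2) ^ m * (1 - 1 / 2) ^ (v - m))) = binomialProb v (1 / 2) m := by
  have h : (2 : ℝ) ^ e * (1 / 2) ^ e = 1 := by rw [← mul_pow]; norm_num
  rw [blockCard_epr, binomialProb]
  push_cast
  linear_combination (v.choose m : ℝ) * ((1 / 2) ^ m * (1 - 1 / 2) ^ (v - m)) * h

theorem choose_eq_binomialProb_half_mul {v m : ℕ} (h : m ≤ v) :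
    (v.choose m : ℝ) = binomialProb v (1 / 2) m * 2 ^ v := by
  rw [binomialProb, sub_half, ← pow_add, Nat.add_sub_cancel' h, mul_assoc, ← mul_pow]
  norm_num

/-- A dimension is a probability divided by the weight of one Schmidt vector. For probabilities
comparable up to a factor `2`, a factor `2` between the weights decides. -/
theorem mul_choose_le_choose {p : ℝ} (h0 : 0 < p) (h1 : p < 1) {N n v m e : ℕ} (hm : m ≤ v)
    (h : 1 / 2 * binomialProb v (1 / 2) m ≤ binomialProb N p n)
    (hw : 2 ^ (e + v) * (p ^ n * (1 - p) ^ (N - n)) ≤ 1 / 2) :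
    2 ^ e * v.choose m ≤ N.choose n := by
  have hw0 : 0 < p ^ n * (1 - p) ^ (N - n) := mul_pos (pow_pos h0 _) (pow_pos (sub_pos.2 h1) _)
  have hQ := binomialProb_nonneg (p := 1 / 2) (by norm_num) (by norm_num) v m
  have : (2 : ℝ) ^ e * v.choose m ≤ N.choose n := by
    refine le_of_mul_le_mul_right ?_ hw0
    calc (2 : ℝ) ^ e * v.choose m * (p ^ n * (1 - p) ^ (N - n))
        = 2 ^ (e + v) * (p ^ n * (1 - p) ^ (N - n)) * binomialProb v (1 / 2) m := by
          rw [choose_eq_binomialProb_half_mul hm, pow_add]; ring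
      _ ≤ 1 / 2 * binomialProb v (1 / 2) m := mul_le_mul_of_nonneg_right hw hQ
      _ ≤ binomialProb N p n := h
  exact_mod_cast this

theorem choose_le_mul_choose {p : ℝ} (h0 : 0 < p) (h1 : p < 1) {N n v m e : ℕ} (hm : m ≤ v)
    (h : 1 / 2 * binomialProb N p n ≤ binomialProb v (1 / 2) m)
    (hw : 2 ≤ 2 ^ (e + v) * (p ^ n * (1 - p) ^ (N - n))) :
    N.choose n ≤ 2 ^ e * v.choose m := by
  have hw0 : 0 < p ^ n * (1 - p) ^ (N - n) := mul_pos (pow_pos h0 _) (pow_pos (sub_pos.2 h1) _)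
  have hQ := binomialProb_nonneg (p := 1 / 2) (by norm_num) (by norm_num) v m
  have : (N.choose n : ℝ) ≤ 2 ^ e * v.choose m := by
    refine le_of_mul_le_mul_right ?_ hw0
    calc N.choose n * (p ^ n * (1 - p) ^ (N - n)) = binomialProb N p n := rfl
      _ ≤ 2 * binomialProb v (1 / 2) m := by linarith
      _ ≤ 2 ^ (e + v) * (p ^ n * (1 - p) ^ (N - n)) * binomialProb v (1 / 2) m :=
        mul_le_mul_of_nonneg_right hw hQ
      _ = (2 : ℝ) ^ e * v.choose m * (p ^ n * (1 - p) ^ (N - n)) := by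
          rw [choose_eq_binomialProb_half_mul hm, pow_add]; ring
  exact_mod_cast this

/-- Termwise `√(P Q) ≥ (1 - η) P`, so the square of the sum is at least `(1 - η)^4`; Bernoulli's
inequality finishes. -/
theorem one_sub_le_sq_sum_sqrt {P Q : ℕ → ℝ} {η : ℝ} {W : Finset ℕ} (hη1 : η ≤ 1)
    (hP : ∀ k ∈ W, 0 ≤ P k) (h : ∀ k ∈ W, (1 - η) ^ 2 * P k ≤ Q k)
    (hsum : 1 - η ≤ ∑ k ∈ W, P k) : 1 - 4 * η ≤ (∑ k ∈ W, √(P k * Q k)) ^ 2 := by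
  have hterm : ∀ k ∈ W, (1 - η) * P k ≤ √(P k * Q k) := fun k hk => by
    refine Real.le_sqrt_of_sq_le ?_
    have := mul_le_mul_of_nonneg_left (h k hk) (hP k hk)
    calc ((1 - η) * P k) ^ 2 = P k * ((1 - η) ^ 2 * P k) := by ring
      _ ≤ _ := this
  have h1 : (1 - η) ^ 2 ≤ ∑ k ∈ W, √(P k * Q k) := by
    refine le_trans ?_ (Finset.sum_le_sum hterm)
    rw [← Finset.mul_sum, sq]
    exact mul_le_mul_of_nonneg_left hsum (sub_nonneg.2 hη1)
  have h2 := pow_le_pow_left₀ (sq_nonneg _) h1 2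
  have h3 := one_add_mul_le_pow (a := -η) (by linarith) 4
  calc 1 - 4 * η ≤ (1 + -η) ^ 4 := by push_cast at h3; linarith
    _ = ((1 - η) ^ 2) ^ 2 := by ring
    _ ≤ _ := h2

/-- The deviation from the entropy is linear in `n - N * p`, hence of order `√N` on the window. -/
theorem log_weight {p : ℝ} (h0 : 0 < p) (h1 : p < 1) {N n : ℕ} (h : n ≤ N) :
    Real.log (p ^ n * (1 - p) ^ (N - n))
      = -(N * Real.binEntropy p) + (n - N * p) * (Real.log p - Real.log (1 - p)) := by
  have hq : 0 < 1 - p := sub_pos.2 h1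
  rw [Real.log_mul (pow_pos h0 _).ne' (pow_pos hq _).ne', Real.log_pow, Real.log_pow,
    Nat.cast_sub h, Real.binEntropy, Real.log_inv, Real.log_inv]
  ring

theorem eventually_mul_sqrt_add_le (a b : ℝ) {c : ℝ} (hc : 0 < c) :
    ∀ᶠ N : ℕ in Filter.atTop, a * √N + b ≤ N * c := by
  have hsqrt : Filter.Tendsto (fun N : ℕ => √(N : ℝ)) Filter.atTop Filter.atTop :=
    Real.tendsto_sqrt_atTop.comp tendsto_natCast_atTop_atTop
  filter_upwards [hsqrt.eventually_ge_atTop ((|a| + |b|) / c), hsqrt.eventually_ge_atTop 1]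
    with N h1 h2
  rw [div_le_iff₀ hc] at h1
  have hSS : √(N : ℝ) * √N = N := Real.mul_self_sqrt (Nat.cast_nonneg _)
  calc a * √N + b ≤ |a| * √N + |b| * √N := add_le_add
        (mul_le_mul_of_nonneg_right (le_abs_self a) (Real.sqrt_nonneg _))
        ((le_abs_self b).trans (le_mul_of_one_le_right (abs_nonneg b) h2))
    _ = √N * (|a| + |b|) := by ring
    _ ≤ √N * (√N * c) := mul_le_mul_of_nonneg_left h1 (Real.sqrt_nonneg _)
    _ = N * c := by rw [← mul_assoc, hSS]

theorem converts_pow_epr {φ : Ket qubit qubit} {p : ℝ} (h00 : φ (0, 0) = 0) (h11 : φ (1, 1) = 0)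
    (h10 : ‖φ (1, 0)‖ ^ 2 = p) (h01 : ‖φ (0, 1)‖ ^ 2 = 1 - p) {N e v : ℕ} {ε : ℝ} (n₁ m₁ : ℕ)
    (W : Finset ℕ) (hcard : ∀ k ∈ W, 2 ^ e * v.choose (m₁ + k) ≤ N.choose (n₁ + k))
    (h : 1 - ε ≤ (∑ k ∈ W, √(binomialProb N p (n₁ + k) * binomialProb v (1 / 2) (m₁ + k))) ^ 2) :
    Converts (φ.pow N) ((eEPR.pow e).tensor (vEPR.pow v)) ε := by
  refine converts_of_blocks (isBlockState_pow h00 h11 h10 h01 N) (isBlockState_epr e v) n₁ m₁ W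
    (fun k hk => ?_) ?_
  · rw [blockCard_epr, blockCard_card]
    exact hcard k hk
  · simp only [blockCard_pow_mul, blockCard_epr_mul]
    exact h

theorem converts_epr_pow {φ : Ket qubit qubit} {p : ℝ} (h00 : φ (0, 0) = 0) (h11 : φ (1, 1) = 0)
    (h10 : ‖φ (1, 0)‖ ^ 2 = p) (h01 : ‖φ (0, 1)‖ ^ 2 = 1 - p) {N e v : ℕ} {ε : ℝ} (n₁ m₁ : ℕ)
    (W : Finset ℕ) (hcard : ∀ k ∈ W, N.choose (n₁ + k) ≤ 2 ^ e * v.choose (m₁ + k))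
    (h : 1 - ε ≤ (∑ k ∈ W, √(binomialProb N p (n₁ + k) * binomialProb v (1 / 2) (m₁ + k))) ^ 2) :
    Converts ((eEPR.pow e).tensor (vEPR.pow v)) (φ.pow N) ε := by
  refine converts_of_blocks (isBlockState_epr e v) (isBlockState_pow h00 h11 h10 h01 N) m₁ n₁ W
    (fun k hk => ?_) ?_
  · rw [blockCard_epr, blockCard_card]
    exact hcard k hk
  · simp only [blockCard_pow_mul, blockCard_epr_mul]
    simpa only [mul_comm] using h

/-- All states here have a single block; `φ.pow N` has dimension one, and superfluous E-EPR pairs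
are shrunk away. -/
theorem converts_product {φ : Ket qubit qubit} {a₀ b₀ : Fin 2}
    (h₀ : ‖φ (a₀, b₀)‖ = 1) (h : ∀ a b, φ (a, b) ≠ 0 → a = a₀ ∧ b = b₀) (N e : ℕ) {ε : ℝ}
    (hε : 0 ≤ ε) :
    Converts (φ.pow N) ((eEPR.pow 0).tensor (vEPR.pow 0)) ε ∧
      Converts ((eEPR.pow e).tensor (vEPR.pow 0)) (φ.pow N) ε := by
  have hunit : blockCard (fun _ : Unit => 0) 0 = 1 := by simp [blockCard]
  constructor
  · refine converts_of_blocks (isBlockState_pow_unit h₀ h N) (isBlockState_epr 0 0) 0 0 {0}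
      (fun k hk => ?_) ?_
    · obtain rfl := Finset.mem_singleton.1 hk
      rw [blockCard_epr, hunit]
      simp
    · simp only [Finset.sum_singleton, blockCard_epr_mul, hunit]
      simpa [binomialProb] using hε
  · refine converts_of_blocks (isBlockState_epr e 0) (isBlockState_pow_unit h₀ h N) 0 0 {0}
      (fun k hk => ?_) ?_
    · obtain rfl := Finset.mem_singleton.1 hk
      rw [blockCard_epr, hunit]
      simpa using Nat.one_le_two_pow
    · simp only [Finset.sum_singleton, blockCard_epr_mul, hunit]
      simpa [binomialProb] using hε

theorem two_pow_mul_eq_exp {w : ℝ} (hw : 0 < w) (j : ℕ) :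
    (2 : ℝ) ^ j * w = Real.exp (j * Real.log 2 + Real.log w) := by
  rw [Real.exp_add, Real.exp_log hw, Real.exp_nat_mul, Real.exp_log two_pos]

theorem eventually_converts {φ : Ket qubit qubit} {p : ℝ} (h0 : 0 < p) (h1 : p < 1)
    (h00 : φ (0, 0) = 0) (h11 : φ (1, 1) = 0)
    (h10 : ‖φ (1, 0)‖ ^ 2 = p) (h01 : ‖φ (0, 1)‖ ^ 2 = 1 - p) {δ ε : ℝ} (hδ : 0 < δ) (hε : 0 < ε) :
    ∀ᶠ N : ℕ in Filter.atTop,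
      Converts (φ.pow N)
        ((eEPR.pow ⌊(N : ℝ) * (entropyGap p / Real.log 2 - δ)⌋₊).tensor
          (vEPR.pow ⌊(N : ℝ) * (4 * (p * (1 - p)))⌋₊)) ε ∧
      Converts
        ((eEPR.pow ⌈(N : ℝ) * (entropyGap p / Real.log 2 + δ)⌉₊).tensor
          (vEPR.pow ⌊(N : ℝ) * (4 * (p * (1 - p)))⌋₊)) (φ.pow N) ε := by
  have hl2 : 0 < Real.log 2 := Real.log_pos one_lt_two
  set η := min (ε / 4) (1 / 4) with hη
  have hη0 : 0 < η := lt_min (by linarith) (by norm_num)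
  have hη4 : η ≤ 1 / 4 := min_le_right _ _
  have hηε : 4 * η ≤ ε := by linarith [min_le_left (ε / 4) (1 / 4 : ℝ)]
  have hη2 : 1 / 2 ≤ (1 - η) ^ 2 := by nlinarith
  obtain ⟨K, hK⟩ := exists_window h0 h1 hη0 (by linarith)
  set G := entropyGap p with hG
  set Λ := |Real.log p - Real.log (1 - p)| with hΛ
  have hgap : p = 1 / 2 ∨ 0 < G := by
    by_cases hp : p = 1 / 2
    · exact Or.inl hp
    · exact Or.inr (entropyGap_pos h0 h1 hp)
  -- The slack per copy: `δ`, or the whole gap when the number of E-EPR pairs is cut off at `0`.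
  set c := if 0 < G then min G (δ * Real.log 2) else δ * Real.log 2 with hc
  have hc0 : 0 < c := by
    rw [hc]
    split_ifs with h
    · exact lt_min h (by positivity)
    · positivity
  have hcδ : c ≤ δ * Real.log 2 := by
    rw [hc]
    split_ifs with h
    · exact min_le_right _ _
    · exact le_rfl
  -- One `log 2` pays for the factor `2` between the weights, the other for the floor in `v`.
  filter_upwards [hK, eventually_mul_sqrt_add_le (K * Λ) (2 * Real.log 2) hc0] with N hN hNc
  obtain ⟨n₁, m₁, M, hwin, hsum⟩ := hN
  set v := ⌊(N : ℝ) * (4 * (p * (1 - p)))⌋₊ with hv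
  have hq0 : 0 < 1 - p := sub_pos.2 h1
  have hvle : (v : ℝ) ≤ N * (4 * (p * (1 - p))) := Nat.floor_le (by positivity)
  have hvlt : N * (4 * (p * (1 - p))) < v + 1 := Nat.lt_floor_add_one _
  have hHG : Real.binEntropy p = G + 4 * Real.log 2 * (p * (1 - p)) := by
    rw [hG, entropyGap]; ring
  have hPnn : ∀ k ∈ Finset.range M, 0 ≤ binomialProb N p (n₁ + k) := fun k _ =>
    binomialProb_nonneg h0.le h1.le _ _
  have hfid : 1 - ε ≤ (∑ k ∈ Finset.range M,
      √(binomialProb N p (n₁ + k) * binomialProb v (1 / 2) (m₁ + k))) ^ 2 :=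
    le_trans (by linarith) (one_sub_le_sq_sum_sqrt (P := fun k => binomialProb N p (n₁ + k))
      (Q := fun k => binomialProb v (1 / 2) (m₁ + k)) (by linarith) hPnn
      (fun k hk => (hwin k hk).2.2.2.1) hsum)
  have hdev : ∀ k ∈ Finset.range M, |(((n₁ + k : ℕ) : ℝ) - N * p) *
      (Real.log p - Real.log (1 - p))| ≤ K * Λ * √N := fun k hk => by
    rw [abs_mul]
    calc _ ≤ K * √N * Λ := mul_le_mul_of_nonneg_right (hwin k hk).1 (abs_nonneg _)
      _ = _ := by ring
  have hw : ∀ n : ℕ, 0 < p ^ n * (1 - p) ^ (N - n) := fun n =>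
    mul_pos (pow_pos h0 _) (pow_pos hq0 _)
  have hNc' : K * Λ * √N + 2 * Real.log 2 ≤ N * (δ * Real.log 2) :=
    hNc.trans (mul_le_mul_of_nonneg_left hcδ (Nat.cast_nonneg _))
  have hvlog : (v : ℝ) * Real.log 2 ≤ N * (4 * Real.log 2 * (p * (1 - p))) := by
    calc _ ≤ N * (4 * (p * (1 - p))) * Real.log 2 := mul_le_mul_of_nonneg_right hvle hl2.le
      _ = _ := by ring
  have hvlog' : N * (4 * Real.log 2 * (p * (1 - p))) ≤ (v + 1 : ℝ) * Real.log 2 := by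
    calc _ = N * (4 * (p * (1 - p))) * Real.log 2 := by ring
      _ ≤ _ := mul_le_mul_of_nonneg_right hvlt.le hl2.le
  constructor
  · rcases hgap with hhalf | hGpos
    -- There is no slack here, but none is needed: `e = 0` and `v = N`, so dimensions and
    -- distributions coincide exactly.
    · have hG0 : G = 0 := by rw [hG, hhalf, entropyGap_half]
      have he : ⌊(N : ℝ) * (G / Real.log 2 - δ)⌋₊ = 0 := Nat.floor_of_nonpos (by
        rw [hG0, zero_div, zero_sub]
        exact mul_nonpos_of_nonneg_of_nonpos (Nat.cast_nonneg _) (by linarith))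
      have hvN : v = N := by
        rw [hv, hhalf]
        norm_num
      rw [he, hvN]
      refine converts_pow_epr h00 h11 h10 h01 0 0 (Finset.range (N + 1)) (fun k _ => by simp) ?_
      have hs : ∀ k ∈ Finset.range (N + 1),
          √(binomialProb N p (0 + k) * binomialProb N (1 / 2) (0 + k)) = binomialProb N p k := by
        intro k _
        rw [zero_add, ← hhalf, Real.sqrt_mul_self (binomialProb_nonneg h0.le h1.le _ _)]
      rw [Finset.sum_congr rfl hs, sum_binomialProb]
      linarith
    · refine converts_pow_epr h00 h11 h10 h01 n₁ m₁ (Finset.range M) (fun k hk => ?_) hfid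
      obtain ⟨-, hn, hm, -, hQP⟩ := hwin k hk
      refine mul_choose_le_choose h0 h1 hm (le_trans (mul_le_mul_of_nonneg_right hη2
        (binomialProb_nonneg (by norm_num) (by norm_num) _ _)) hQP) ?_
      rw [two_pow_mul_eq_exp (hw _), log_weight h0 h1 hn, one_div, ← Real.exp_log two_pos,
        ← Real.exp_neg, Real.exp_le_exp, Real.log_exp]
      have hcG : c ≤ G := by rw [hc, if_pos hGpos]; exact min_le_left _ _
      have he : (⌊(N : ℝ) * (G / Real.log 2 - δ)⌋₊ : ℝ) * Real.log 2 ≤ N * (G - c) := by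
        rcases le_or_gt 0 ((N : ℝ) * (G / Real.log 2 - δ)) with hpos | hneg
        · calc _ ≤ N * (G / Real.log 2 - δ) * Real.log 2 :=
                mul_le_mul_of_nonneg_right (Nat.floor_le hpos) hl2.le
            _ = N * (G - δ * Real.log 2) := by field_simp
            _ ≤ N * (G - c) := mul_le_mul_of_nonneg_left (by linarith) (Nat.cast_nonneg _)
        · rw [Nat.floor_of_nonpos hneg.le, Nat.cast_zero, zero_mul]
          exact mul_nonneg (Nat.cast_nonneg _) (by linarith)
      have hd := (abs_le.1 (hdev k hk)).2
      rw [hHG]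
      push_cast at hd ⊢
      linarith
  · refine converts_epr_pow h00 h11 h10 h01 n₁ m₁ (Finset.range M) (fun k hk => ?_) hfid
    obtain ⟨-, hn, hm, hPQ, -⟩ := hwin k hk
    refine choose_le_mul_choose h0 h1 hm (le_trans (mul_le_mul_of_nonneg_right hη2
      (hPnn k hk)) hPQ) ?_
    rw [two_pow_mul_eq_exp (hw _), log_weight h0 h1 hn]
    nth_rewrite 1 [← Real.exp_log two_pos]
    rw [Real.exp_le_exp]
    have he : N * G + N * (δ * Real.log 2)
        ≤ (⌈(N : ℝ) * (G / Real.log 2 + δ)⌉₊ : ℝ) * Real.log 2 := by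
      calc _ = N * (G / Real.log 2 + δ) * Real.log 2 := by field_simp
        _ ≤ _ := mul_le_mul_of_nonneg_right (Nat.le_ceil _) hl2.le
    have hd := (abs_le.1 (hdev k hk)).1
    rw [hHG]
    push_cast at hd ⊢
    linarith

end SSR

theorem mainTheorem3 (φ : SSR.Ket SSR.qubit SSR.qubit) (hφ : SSR.IsPureState φ) :
    φ.siv ≤ φ.entanglement ∧
    ∀ δ : ℝ, 0 < δ → ∀ ε : ℝ, 0 < ε → ∃ N₀ : ℕ, ∀ N : ℕ, N₀ ≤ N →
      SSR.Converts (φ.pow N)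
        ((SSR.eEPR.pow ⌊(N : ℝ) * (φ.entanglement - φ.siv - δ)⌋₊).tensor
          (SSR.vEPR.pow ⌊(N : ℝ) * φ.siv⌋₊)) ε ∧
      SSR.Converts
        ((SSR.eEPR.pow ⌈(N : ℝ) * (φ.entanglement - φ.siv + δ)⌉₊).tensor
          (SSR.vEPR.pow ⌊(N : ℝ) * φ.siv⌋₊))
        (φ.pow N) ε := by
  have hl2 : 0 < Real.log 2 := Real.log_pos one_lt_two
  have hdiff : φ.entanglement - φ.siv = SSR.entropyGap (SSR.occupation φ) / Real.log 2 := by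
    rw [SSR.entanglement_eq hφ, SSR.siv_eq, SSR.entropyGap]
    field_simp
  rcases hφ.qubit_cases with ⟨h0, h1, h00, h11, h10, h01⟩ | ⟨hp, a₀, b₀, h₀, hsupp⟩
  · constructor
    · rw [← sub_nonneg, hdiff]
      refine div_nonneg ?_ hl2.le
      by_cases hp : SSR.occupation φ = 1 / 2
      · rw [hp, SSR.entropyGap_half]
      · exact (SSR.entropyGap_pos h0 h1 hp).le
    · intro δ hδ ε hε
      rw [hdiff, SSR.siv_eq]
      exact Filter.eventually_atTop.1 (SSR.eventually_converts h0 h1 h00 h11 h10 h01 hδ hε)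
  -- A product state: the floors give no EPR pairs of either kind as targets, and the conversions
  -- hold for every `N`.
  · have hsiv : φ.siv = 0 := by
      rw [SSR.siv_eq]
      rcases hp with hp | hp <;> simp [hp]
    have hent : φ.entanglement = 0 := by
      rw [SSR.entanglement_eq hφ]
      rcases hp with hp | hp <;> simp [hp]
    refine ⟨by rw [hsiv, hent], fun δ hδ ε hε => ⟨0, fun N _ => ?_⟩⟩
    have he : ⌊(N : ℝ) * (φ.entanglement - φ.siv - δ)⌋₊ = 0 := Nat.floor_of_nonpos (by
      rw [hsiv, hent, sub_zero, zero_sub]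
      exact mul_nonpos_of_nonneg_of_nonpos (Nat.cast_nonneg _) (by linarith))
    have hv : ⌊(N : ℝ) * φ.siv⌋₊ = 0 := by rw [hsiv, mul_zero, Nat.floor_zero]
    rw [he, hv]
    exact SSR.converts_product h₀ hsupp N _ hε.le
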